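/- Let $\Phi$ be the (irreducible) root system of a simple, simply connected algebraic group, with weight lattice $\mathbb{X}$ (on which coroots $\alpha^\vee$ take the values $\langle\cdot,\alpha^\vee\rangle$), positive roots $\Phi^+$, dominant weights $\mathbb{X}^+$, Weyl group $W$, $\rho$ the sum of the fundamental weights $\varpi_1,\dots,\varpi_n$, and $\alpha_0^\vee$ the highest coroot. Let $p$ be a prime. For $\mu,\mu'\in\mathbb{X}$ write $\mu\le\mu'$ if $\mu'-\mu$ is a sum of simple roots. Let $\uparrow$ be the reflexive and transitive relation on $\mathbb{X}$ generated by $x\uparrow s_{\alpha,np}\cdot x$ whenever $\alpha\in\Phi^+$, $n\in\mathbb{Z}$ and $x\le s_{\alpha,np}\cdot x$, where $s_{\alpha,np}\cdot x=x-(\langle x+\rho,\alpha^\vee\rangle-np)\alpha$. For $m\ge 0$ put $\mathbb{X}_m=\{\sum a_i\varpi_i : 0\le a_i<m\}$. In the group ring $\mathbb{Z}[\mathbb{X}]$ with basis $e(\mu)$, let $s(\mu)=\sum_{\nu\in W\mu}e(\nu)$ and let $\chi(\mu)$ be the character $\sum_{w\in W}(-1)^{\ell(w)}e(w(\mu+\rho))\big/\sum_{w\in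 W}(-1)^{\ell(w)}e(w\rho)$. The Weyl characters $\chi(\mu)$, $\mu\in\mathbb{X}^+$, form a $\mathbb{Z}$-basis of $\mathbb{Z}[\mathbb{X}]^W$. An element of $\mathbb{Z}[\mathbb{X}]^W$ is a good filtration character if it is nonzero and its coefficients in this basis are nonnegative. An element $\eta\in\mathbb{Z}[\mathbb{X}]^W$ has the good Steinberg multiplication property if $\eta\,\chi((p-1)\rho+p\gamma)$ is a good filtration character for every $\gamma\in\mathbb{X}^+$. Fix $\lambda\in\mathbb{X}^+$, let $\Psi^+=\{\gamma\in\mathbb{X}^+ : (\gamma-\rho)\uparrow(\lambda-\rho)\}$, and let $m$ be the least integer with $\langle\lambda,\alpha_0^\vee\rangle<pm$. Consider the following algorithm. Start with $\eta=s(\lambda)$ and repeat: 1. Choose a weight $\mu$ that is maximal with respect to $\le$ among the weights in $\Psi^+$ whose orbit sum $s(\mu)$ has multiplicity $0$ in $\eta$. If there is none, stop and return $\eta$. 2. For each $\gamma\in\mathbb{X}_m$ expand $\chi((p-1)\rho+p\gamma)\,\eta$ in the basis of Weyl characters. 3. Let $x_\mu$ be the least of the coefficients (zero coefficients included) of the Weyl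 characters $\chi((p-1)\rho+p\gamma+w\mu)$ in these expansions, over all $\gamma\in\mathbb{X}_m$ and $w\in W$ for which $(p-1)\rho+p\gamma+w\mu$ is dominant. 4. Replace $\eta$ by $\eta-x_\mu s(\mu)$. Then the algorithm terminates after finitely many computations: the sets $\Psi^+$, $\mathbb{X}_m$ and $W$ are finite, the integer $x_\mu$ exists and is uniquely determined at every stage and for every possible choice of $\mu$, and there is a bound on the number of passes through the loop that holds for all possible choices. All runs of the algorithm return the same element, whatever choices are made in Step 1, and this element has the good Steinberg multiplication property. -/

import Mathlib

noncomputable section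

namespace SteinbergMult

open AddMonoidAlgebra

/-! ### Root data of simple simply connected groups -/

section RootDatum

variable {ι X Y : Type*} [AddCommGroup X] [AddCommGroup Y]

/-- A root datum over `ℤ` is (semisimple and) simply connected if its coroots span the cocharacter
lattice `Y`. Equivalently, the character lattice `X` is the full weight lattice. -/
class IsSimplyConnected (P : RootPairing ι ℤ X Y) : Prop where
  span_coroot : Submodule.span ℤ (Set.range P.coroot) = ⊤

/-- The root system is irreducible: it is nonempty, and it is not the union of two nonempty
mutually orthogonal subsets. (Mathlib's `RootPairing.IsIrreducible` is meant for coefficient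
fields; over `ℤ` it fails for lattices such as `2X ⊂ X`.) -/
class IsIrreducibleDatum (P : RootPairing ι ℤ X Y) : Prop where
  nonempty : Nonempty ι
  eq_univ (s : Set ι) (hs : s.Nonempty)
    (horth : ∀ i ∈ s, ∀ j ∉ s, P.pairing i j = 0 ∧ P.pairing j i = 0) : s = Set.univ

variable {P : RootPairing ι ℤ X Y} (b : P.Base)

/-- The natural pairing `⟨x, αᵢ^∨⟩` of a weight with a coroot. -/
def pair (P : RootPairing ι ℤ X Y) (x : X) (i : ι) : ℤ := P.toLinearMap x (P.coroot i)

theorem linearIndependent_simpleCoroot :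
    LinearIndependent ℤ fun i : b.support => P.coroot i :=
  b.linearIndepOn_coroot

/-- The simple coroots form a basis of the cocharacter lattice of a simply connected datum. -/
def simpleCorootBasis [IsSimplyConnected P] : Module.Basis b.support ℤ Y :=
  Module.Basis.mk (v := fun i : b.support => P.coroot i) (linearIndependent_simpleCoroot b) (by
    have h : (Set.range fun i : b.support => P.coroot i) = P.coroot '' (b.support : Set ι) := by
      rw [Set.image_eq_range]; rfl
    rw [h, b.span_int_coroot_support, IsSimplyConnected.span_coroot])

/-- The fundamental dominant weights `ϖᵢ`: the basis of `X` dual to the simple coroots. -/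
def fundamentalWeight [IsSimplyConnected P] (i : b.support) : X :=
  P.toPerfPair.symm ((simpleCorootBasis b).coord i)

open Classical in
theorem pair_fundamentalWeight [IsSimplyConnected P] (i j : b.support) :
    pair P (fundamentalWeight b i) j = if i = j then 1 else 0 := by
  have h : P.toLinearMap (fundamentalWeight b i) = (simpleCorootBasis b).coord i :=
    P.toPerfPair.apply_symm_apply _
  have h2 : P.coroot j = simpleCorootBasis b j := by
    rw [simpleCorootBasis, Module.Basis.mk_apply]
  rw [pair, h, h2, Module.Basis.coord_apply, Module.Basis.repr_self, Finsupp.single_apply]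
  simp only [eq_comm]

/-- `ρ`, the sum of the fundamental dominant weights. -/
def rho [IsSimplyConnected P] : X := ∑ i : b.support, fundamentalWeight b i

/-- The dominant weights `X⁺`. -/
def IsDominant (x : X) : Prop := ∀ i ∈ b.support, 0 ≤ pair P x i

/-- The `m`-restricted weights `X_m = {∑ aᵢ ϖᵢ | 0 ≤ aᵢ < m}`. -/
def restrictedWeights (m : ℕ) : Set X := {x | ∀ i ∈ b.support, 0 ≤ pair P x i ∧ pair P x i < m}

/-- The standard partial order on weights: `x ≤ y` if `y - x` is a sum of simple roots. -/
def WeightLE (x y : X) : Prop := y - x ∈ AddSubmonoid.closure (P.root '' b.support)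

theorem exists_highest [Finite ι] [IsIrreducibleDatum P] [IsSimplyConnected P] :
    ∃ i : ι, ∀ j : ι, pair P (rho b) j ≤ pair P (rho b) i :=
  have : Nonempty ι := IsIrreducibleDatum.nonempty P
  Finite.exists_max _

/-- The index of the highest coroot `α₀^∨` (equivalently of the highest short root `α₀`): the
coroot of maximal height, where the height of a coroot is its pairing with `ρ`, that is, the sum
of its coefficients with respect to the simple coroots. -/
def highestCoroot [Finite ι] [IsIrreducibleDatum P] [IsSimplyConnected P] : ι :=
  (exists_highest b).choose

/-- The dot action of the affine reflection `s_{α,np}`, i.e. `s_{α,np}(x + ρ) - ρ` where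
`s_{α,np}(y) = y - (⟨y, α^∨⟩ - np) α`. -/
def dotAffineReflection [IsSimplyConnected P] (p : ℕ) (i : ι) (n : ℤ) (x : X) : X :=
  (x + rho b) - (pair P (x + rho b) i - n * p) • P.root i - rho b

/-- The order `↑` on `X`: `x ↑ y` if there are affine reflections with
`x ≤ s₁ ∙ x ≤ s₂ ∙ s₁ ∙ x ≤ ⋯ ≤ s_m ∙ ⋯ ∙ s₁ ∙ x = y`. -/
def UpArrow [Finite ι] [P.IsReduced] [IsSimplyConnected P] (p : ℕ) : X → X → Prop :=
  Relation.ReflTransGen fun x y =>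
    ∃ i, b.IsPos i ∧ ∃ n : ℤ, y = dotAffineReflection b p i n x ∧ WeightLE b x y

end RootDatum

/-! ### Characters -/

section Characters

variable {ι X Y : Type*} [AddCommGroup X] [AddCommGroup Y] {P : RootPairing ι ℤ X Y} (b : P.Base)

/-- Membership in `ℤ[X]^W`. -/
def IsWeylInvariant (P : RootPairing ι ℤ X Y) (η : AddMonoidAlgebra ℤ X) : Prop :=
  ∀ (w : P.weylGroup) (x : X), η.coeff (w • x) = η.coeff x

/-- The orbit sum `s(μ) = ∑_{ν ∈ Wμ} e(ν)`. -/
def orbitSum (P : RootPairing ι ℤ X Y) (μ : X) : AddMonoidAlgebra ℤ X :=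
  ∑ᶠ ν ∈ MulAction.orbit P.weylGroup μ, single ν (1 : ℤ)

/-- The sign `(-1)^{ℓ(w)}`, which is the determinant of `w` on `X`. -/
def sign (w : P.weylGroup) : ℤ := LinearMap.det (P.weylGroupRootRep w)

/-- The alternating sum `∑_{w ∈ W} (-1)^{ℓ(w)} e(wx)`. -/
def alternant (P : RootPairing ι ℤ X Y) (x : X) : AddMonoidAlgebra ℤ X :=
  ∑ᶠ w : P.weylGroup, single (w • x) (sign w)

open Classical in
/-- The character `χ(ν)`, by Weyl's formula: the element of `ℤ[X]` that is the quotient of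
`∑ (-1)^{ℓ(w)} e(w(ν + ρ))` by `∑ (-1)^{ℓ(w)} e(wρ)`. -/
def weylChar [IsSimplyConnected P] (ν : X) : AddMonoidAlgebra ℤ X :=
  if h : ∃ c, c * alternant P (rho b) = alternant P (ν + rho b) then h.choose else 0

/-- `η = ∑ a_ν χ(ν)`, the sum over dominant `ν`: the expression of `η` in the basis of Weyl
characters. -/
def IsWeylExpansion [IsSimplyConnected P] (η : AddMonoidAlgebra ℤ X) (a : X →₀ ℤ) : Prop :=
  (∀ ν ∈ a.support, IsDominant b ν) ∧ η = a.sum fun ν c => c • weylChar b ν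

/-- A good filtration character: a nonzero element of `ℤ[X]^W` with nonnegative coefficients in
the basis of Weyl characters. -/
def IsGoodFiltrationChar [IsSimplyConnected P] (η : AddMonoidAlgebra ℤ X) : Prop :=
  η ≠ 0 ∧ IsWeylInvariant P η ∧ ∃ a : X →₀ ℤ, IsWeylExpansion b η a ∧ ∀ ν, 0 ≤ a ν

/-- The weight `(p - 1)ρ + pγ`. -/
def steinbergWeight [IsSimplyConnected P] (p : ℕ) (γ : X) : X :=
  ((p : ℤ) - 1) • rho b + (p : ℤ) • γ

/-- The good Steinberg multiplication property of `η ∈ ℤ[X]^W`. -/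
def HasGoodSteinbergMult [IsSimplyConnected P] (p : ℕ) (η : AddMonoidAlgebra ℤ X) : Prop :=
  IsWeylInvariant P η ∧
    ∀ γ, IsDominant b γ → IsGoodFiltrationChar b (η * weylChar b (steinbergWeight b p γ))

end Characters

/-! ### The algorithm -/

section Algorithm

variable {ι X Y : Type*} [Finite ι] [AddCommGroup X] [AddCommGroup Y] {P : RootPairing ι ℤ X Y}
  [P.IsReduced] [IsIrreducibleDatum P] [IsSimplyConnected P] (b : P.Base) (p : ℕ) (lam : X)

/-- The set `Ψ⁺` of dominant `γ` with `(γ - ρ) ↑ (λ - ρ)`. -/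
def psiPlus : Set X := {γ | IsDominant b γ ∧ UpArrow b p (γ - rho b) (lam - rho b)}

/-- The minimal integer `m` with `⟨λ, α₀^∨⟩ < pm` (it is positive for dominant `λ`). -/
def bound : ℕ := sInf {m : ℕ | pair P lam (highestCoroot b) < p * m}

/-- Step (1): `μ` may be chosen at the stage at which the current value is `η`, i.e. it is maximal
in `Ψ⁺` among the weights whose orbit sum has multiplicity `0` in `η`. The multiplicity of `s(μ)`
(`μ` dominant) in an element of `ℤ[X]^W` is the coefficient of `e(μ)`. -/
def IsChoice (η : AddMonoidAlgebra ℤ X) (μ : X) : Prop :=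
  μ ∈ psiPlus b p lam ∧ η.coeff μ = 0 ∧
    ∀ μ' ∈ psiPlus b p lam, η.coeff μ' = 0 → WeightLE b μ μ' → μ' = μ

/-- Steps (2) and (3): `x` is the least of the coefficients of the Weyl characters
`χ((p-1)ρ + pγ + wμ)` in the expansions of `χ((p-1)ρ + pγ) η`, over all `γ ∈ X_m` and `w ∈ W`
(for which `(p-1)ρ + pγ + wμ` is dominant). -/
def IsLeastCoeff (η : AddMonoidAlgebra ℤ X) (μ : X) (x : ℤ) : Prop :=
  ∃ a : X → X →₀ ℤ,
    (∀ γ ∈ restrictedWeights b (bound b p lam),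
      IsWeylExpansion b (weylChar b (steinbergWeight b p γ) * η) (a γ)) ∧
    IsLeast {z : ℤ | ∃ γ ∈ restrictedWeights b (bound b p lam), ∃ w : P.weylGroup,
      IsDominant b (steinbergWeight b p γ + w • μ) ∧ z = a γ (steinbergWeight b p γ + w • μ)} x

/-- One pass through the loop, from the current value `η` to the next value `η'`. -/
def Step (η η' : AddMonoidAlgebra ℤ X) : Prop :=
  ∃ μ x, IsChoice b p lam η μ ∧ IsLeastCoeff b p lam η μ x ∧ η' = η - x • orbitSum P μ

/-- `η` is the value at some stage of some run of the algorithm, which starts from `s(λ)`. -/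
def IsReachable (η : AddMonoidAlgebra ℤ X) : Prop :=
  Relation.ReflTransGen (Step b p lam) (orbitSum P lam) η

/-- `η` is returned by some run: it is reached, and no weight can be chosen in Step (1). -/
def IsOutput (η : AddMonoidAlgebra ℤ X) : Prop :=
  IsReachable b p lam η ∧ ∀ μ, ¬ IsChoice b p lam η μ

end Algorithm

end SteinbergMult

end

-- Put $\delta=\gamma+\rho$, so that $\chi((p-1)\rho+p\gamma)=\chi(p\delta-\rho)$. Multiplying by
-- the Weyl denominator gives Brauer's formula: for invariant $\eta$, the coefficient of
-- $\chi(p\delta-\rho+y)$ in $\eta\,\chi(p\delta-\rho)$ is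
-- $\sum_u(-1)^{\ell(u)}\eta(u(p\delta+y)-p\delta)$, where $\eta(x)$ is the coefficient of $e(x)$
-- (`brauerCoeff`). The term $u=1$ is $\eta(y)$. Every other term is evaluated at a weight reached
-- from $y$ by reflections in hyperplanes that separate the new weight from $0$ and from the old
-- one. The preorder `SepLE` is generated by such reflections and by $W$. Hence the coefficients are
-- unitriangular (`brauerCoeff_sub_eq`).
--
-- The link with $\uparrow$ is `upArrow_iff_sepLE`: on dominant weights, after the shift by $\rho$,
-- the two orders agree. The hard direction moves a base point $-t\xi$ from infinity, where
-- $\uparrow$ consists of reflections away from the base point, to a point near $0$, where such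
-- reflections generate `SepLE`. The walls are crossed one at a time, and chains of reflections are
-- folded at each crossing.
--
-- Two facts make the algorithm work. First, truncating the coordinates of $\delta$ at $m$ leaves
-- the coefficients unchanged, so the finitely many $\gamma\in\mathbb{X}_m$ decide positivity for
-- all $\gamma$ (`brauerCoeff_truncate`). Second, if $\eta(x)=0$ and $z$ is one separating
-- reflection above $x$, a suitable $\delta$ makes $-\eta(z)$ one of the coefficients
-- (`exists_brauerCoeff_eq_neg`). For a choice $\mu$, maximality makes such an $\eta(z)$ positive,
-- so $x_\mu<0$. The multiplicity of $s(\mu)$ becomes positive and stays so, and there are at most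
-- $|\Psi^+|$ passes.
--
-- By unitriangularity, subtracting $x_\mu s(\mu)$ makes the least coefficient at $\mu$ equal to
-- $0$, and later passes do not disturb it (`IsStage`, `IsStage.step`). In an output the least
-- coefficient is therefore $0$ at every $\nu\in\Psi^+$ other than $\lambda$, and $\eta(\lambda)=1$.
-- Descending induction on height shows that this determines the output, and truncation turns it
-- into the good Steinberg multiplication property.

noncomputable section

namespace SteinbergMult

open AddMonoidAlgebra

-- Weyl group action on weights and on root indices

section Pairing

variable {ι X Y : Type*} [AddCommGroup X] [AddCommGroup Y] {P : RootPairing ι ℤ X Y}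

theorem pair_add (x y : X) (i : ι) : pair P (x + y) i = pair P x i + pair P y i := by
  simp [pair]

theorem pair_sub (x y : X) (i : ι) : pair P (x - y) i = pair P x i - pair P y i := by
  simp [pair]

theorem pair_neg (x : X) (i : ι) : pair P (-x) i = -pair P x i := by
  simp [pair]

theorem pair_smul (n : ℤ) (x : X) (i : ι) : pair P (n • x) i = n * pair P x i := by
  simp [pair]

theorem pair_zero (i : ι) : pair P (0 : X) i = 0 := by
  simp [pair]

theorem pair_root (i j : ι) : pair P (P.root i) j = P.pairing i j := rfl

theorem pair_root_self (i : ι) : pair P (P.root i) i = 2 := P.root_coroot_two i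

/-- The reflection in the root of index `i`. -/
def refl (P : RootPairing ι ℤ X Y) (i : ι) : P.weylGroup := RootPairing.weylGroup.ofIdx P i

theorem refl_smul (i : ι) (x : X) : refl P i • x = x - pair P x i • P.root i := rfl

theorem refl_smul_index (i j : ι) : refl P i • j = P.reflectionPerm i j := rfl

theorem root_smul (w : P.weylGroup) (i : ι) : P.root (w • i) = w • P.root i :=
  RootPairing.weylGroup_apply_root P w i |>.symm

theorem smul_zsmul (w : P.weylGroup) (n : ℤ) (x : X) : w • (n • x) = n • w • x :=
  smul_comm w n x

theorem weyl_ext {w w' : P.weylGroup} (h : ∀ x : X, w • x = w' • x) : w = w' := by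
  apply Subtype.ext
  apply RootPairing.Equiv.weightHom_injective P
  ext x
  exact h x

theorem refl_mul_self (i : ι) : refl P i * refl P i = 1 := by
  apply weyl_ext
  intro x
  rw [mul_smul, one_smul]
  exact P.reflection_same i x

theorem refl_smul_smul_index (i j : ι) : refl P i • refl P i • j = j := by
  rw [← mul_smul, refl_mul_self, one_smul]

theorem refl_inv (i : ι) : (refl P i)⁻¹ = refl P i :=
  inv_eq_of_mul_eq_one_left (refl_mul_self i)

theorem coroot_refl_smul (i j : ι) :
    P.coroot (refl P i • j) = P.coroot j - P.pairing i j • P.coroot i := by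
  rw [refl_smul_index, P.coroot_reflectionPerm, P.coreflection_apply_coroot]

theorem pair_refl_smul_index (x : X) (i j : ι) :
    pair P x (refl P i • j) = pair P x j - P.pairing i j * pair P x i := by
  rw [pair, coroot_refl_smul]
  simp [pair]

theorem pair_refl_smul (i j : ι) (x : X) :
    pair P (refl P i • x) (refl P i • j) = pair P x j := by
  rw [refl_smul, pair_sub, pair_smul, pair_refl_smul_index, pair_refl_smul_index, pair_root,
    pair_root_self]
  ring

/-- The induction principle for the generated group multiplies two arbitrary elements. Strengthening
the claim to "left multiplication by $w$ preserves $q$" reduces it to left multiplication by single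
reflections. -/
theorem weyl_induction {q : P.weylGroup → Prop} (one : q 1)
    (mul : ∀ i w, q w → q (refl P i * w)) (w : P.weylGroup) : q w := by
  obtain ⟨w, hw⟩ := w
  have key : ∀ v : P.weylGroup, q v → q (⟨w, hw⟩ * v) := by
    induction hw using RootPairing.weylGroup.induction with
    | mem i => exact fun v hv => mul i v hv
    | one =>
      intro v hv
      have h : (⟨1, one_mem _⟩ : P.weylGroup) = 1 := rfl
      rwa [h, one_mul]
    | mul x y hx hy h1 h2 =>
      intro v hv
      have := h1 _ (h2 _ hv)
      rwa [← mul_assoc] at this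
  simpa using key 1 one

theorem pair_weyl_smul (w : P.weylGroup) (x : X) (i : ι) :
    pair P (w • x) (w • i) = pair P x i := by
  induction w using weyl_induction with
  | one => simp
  | mul j w ih => rw [mul_smul, mul_smul, pair_refl_smul, ih]

theorem pair_weyl_smul_left (w : P.weylGroup) (x : X) (i : ι) :
    pair P (w • x) i = pair P x (w⁻¹ • i) := by
  rw [← pair_weyl_smul w x, smul_inv_smul]

theorem refl_weyl_smul (w : P.weylGroup) (i : ι) : refl P (w • i) = w * refl P i * w⁻¹ := by
  apply weyl_ext
  intro x
  rw [mul_smul, mul_smul, refl_smul, refl_smul, smul_sub, smul_inv_smul, smul_zsmul, root_smul,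
    pair_weyl_smul_left w⁻¹, inv_inv]

/-- The index of the root opposite to the root of index `i`. -/
def negIndex (P : RootPairing ι ℤ X Y) (i : ι) : ι := refl P i • i

theorem root_negIndex (i : ι) : P.root (negIndex P i) = -P.root i := by
  rw [negIndex, root_smul, refl_smul, pair_root_self]; module

theorem pair_negIndex (x : X) (i : ι) : pair P x (negIndex P i) = -pair P x i := by
  rw [negIndex, pair_refl_smul_index, P.pairing_same]; ring

theorem coroot_negIndex (i : ι) : P.coroot (negIndex P i) = -P.coroot i := by
  rw [negIndex, coroot_refl_smul, P.pairing_same]; module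

theorem negIndex_negIndex (i : ι) : negIndex P (negIndex P i) = i := by
  apply P.root.injective
  simp [root_negIndex]

theorem smul_negIndex (w : P.weylGroup) (i : ι) : w • negIndex P i = negIndex P (w • i) := by
  apply P.root.injective
  rw [root_negIndex, root_smul, root_smul, root_negIndex, smul_neg]

end Pairing

-- Positive roots, positive coroots and dominance

section Positive

variable {ι X Y : Type*} [AddCommGroup X] [AddCommGroup Y] {P : RootPairing ι ℤ X Y} (b : P.Base)

theorem isPos_negIndex_iff (i : ι) : b.IsPos (negIndex P i) ↔ ¬ b.IsPos i :=
  RootPairing.Base.IsPos.neg_iff_not b i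

theorem isPos_simple {i : ι} (hi : i ∈ b.support) : b.IsPos i :=
  RootPairing.Base.isPos_of_mem_support hi

theorem isPos_refl_smul [Finite ι] [P.IsReduced] {i j : ι} (hj : j ∈ b.support) (hi : b.IsPos i) (hij : i ≠ j) :
    b.IsPos (refl P j • i) :=
  hi.reflectionPerm hj hij

theorem root_mem_closure_of_isPos [Finite ι] {i : ι} (hi : b.IsPos i) :
    P.root i ∈ AddSubmonoid.closure (P.root '' b.support) := by
  refine hi.induction_on_add (p := fun i => P.root i ∈ AddSubmonoid.closure (P.root '' b.support))
    (fun i hi => AddSubmonoid.subset_closure ⟨i, hi, rfl⟩) ?_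
  intro i j k h hi hj
  rw [h]
  exact add_mem hi (AddSubmonoid.subset_closure ⟨j, hj, rfl⟩)

theorem isPos_refl_smul_iff [Finite ι] [P.IsReduced] {i j : ι} (hj : j ∈ b.support) (hij : i ≠ j)
    (hij' : i ≠ negIndex P j) : b.IsPos (refl P j • i) ↔ b.IsPos i := by
  constructor
  · intro h
    have := isPos_refl_smul b hj h (by
      intro h
      apply hij'
      rw [negIndex, eq_inv_smul_iff.2 h, refl_inv])
    rwa [refl_smul_smul_index] at this
  · exact fun h => isPos_refl_smul b hj h hij

/-- Positivity may be tested on roots or on coroots: on both sides a simple reflection changes only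
the sign of its own root and of the opposite one, so agreement spreads from the simple roots along
reflections. -/
theorem isPos_flip_iff [Finite ι] [P.IsReduced] (i : ι) : b.flip.IsPos i ↔ b.IsPos i := by
  have : Module.IsReflexive ℤ X := .of_isPerfPair P.toLinearMap
  have : Module.IsReflexive ℤ Y := .of_isPerfPair P.flip.toLinearMap
  refine RootPairing.Base.induction_reflect (b := b) i (p := fun i => b.flip.IsPos i ↔ b.IsPos i) ?_ ?_ ?_
  · intro i h
    have h1 := isPos_negIndex_iff b i
    have h2 := isPos_negIndex_iff b.flip i
    change b.flip.IsPos (negIndex P.flip i) ↔ b.IsPos (negIndex P i)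
    tauto
  · intro i hi
    exact iff_of_true (isPos_simple b.flip hi) (isPos_simple b hi)
  · intro i j h hj
    by_cases h1 : i = j
    · subst h1
      have h1 := isPos_negIndex_iff b i
      have h2 := isPos_negIndex_iff b.flip i
      change b.flip.IsPos (negIndex P.flip i) ↔ b.IsPos (negIndex P i)
      tauto
    by_cases h2 : i = negIndex P j
    · subst h2
      have h1 := isPos_negIndex_iff b j
      have h2 := isPos_negIndex_iff b.flip j
      change b.flip.IsPos (refl P j • negIndex P j) ↔ b.IsPos (refl P j • negIndex P j)
      rw [negIndex, refl_smul_smul_index]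
      exact iff_of_true (isPos_simple b.flip hj) (isPos_simple b hj)
    · change b.flip.IsPos (refl P.flip j • i) ↔ b.IsPos (refl P j • i)
      rw [isPos_refl_smul_iff b hj h1 h2, isPos_refl_smul_iff b.flip hj h1 h2, h]

theorem coroot_mem_closure_of_isPos [Finite ι] [P.IsReduced] {i : ι} (hi : b.IsPos i) :
    P.coroot i ∈ AddSubmonoid.closure (P.coroot '' b.support) :=
  root_mem_closure_of_isPos b.flip ((isPos_flip_iff b i).2 hi)

theorem exists_nat_coeff {J : Finset ι} {z : Y}
    (h : z ∈ AddSubmonoid.closure (P.coroot '' J)) :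
    ∃ c : ι → ℕ, z = ∑ j ∈ J, c j • P.coroot j := by
  classical
  induction h using AddSubmonoid.closure_induction with
  | mem x hx =>
    obtain ⟨j, hj, rfl⟩ := hx
    refine ⟨Pi.single j 1, ?_⟩
    rw [Finset.sum_eq_single_of_mem j hj] <;> simp +contextual
  | zero => exact ⟨0, by simp⟩
  | add x y _ _ hx hy =>
    obtain ⟨c, rfl⟩ := hx
    obtain ⟨d, rfl⟩ := hy
    exact ⟨c + d, by simp [add_smul, Finset.sum_add_distrib]⟩

theorem exists_pair_eq_sum [Finite ι] [P.IsReduced] {i : ι} (hi : b.IsPos i) :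
    ∃ c : ι → ℕ, P.coroot i = ∑ j ∈ b.support, c j • P.coroot j ∧
      ∀ x : X, pair P x i = ∑ j ∈ b.support, c j * pair P x j := by
  obtain ⟨c, hc⟩ := exists_nat_coeff (coroot_mem_closure_of_isPos b hi)
  refine ⟨c, hc, fun x => ?_⟩
  rw [pair, hc]
  simp [pair]

theorem pair_nonneg [Finite ι] [P.IsReduced] {x : X} (hx : IsDominant b x) {i : ι} (hi : b.IsPos i) :
    0 ≤ pair P x i := by
  obtain ⟨c, -, hc⟩ := exists_pair_eq_sum b hi
  rw [hc]
  exact Finset.sum_nonneg fun j hj => mul_nonneg (by positivity) (hx j hj)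

/-- A weight is strictly dominant if it pairs positively with the simple coroots. -/
def IsStrictlyDominant (x : X) : Prop := ∀ i ∈ b.support, 0 < pair P x i

variable {b}

theorem IsStrictlyDominant.isDominant {x : X} (hx : IsStrictlyDominant b x) : IsDominant b x :=
  fun i hi => (hx i hi).le

variable (b)

theorem le_pair_of_coroot_eq_sum {x : X} (hx : IsDominant b x) {i j : ι} {c : ι → ℕ}
    (hc : P.coroot i = ∑ k ∈ b.support, c k • P.coroot k) (hj : j ∈ b.support) (hcj : c j ≠ 0) :
    pair P x j ≤ pair P x i := by
  have : pair P x i = ∑ k ∈ b.support, c k * pair P x k := by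
    rw [pair, hc]; simp [pair]
  rw [this]
  calc pair P x j ≤ c j * pair P x j :=
        le_mul_of_one_le_left (hx j hj) (by exact_mod_cast Nat.one_le_iff_ne_zero.2 hcj)
    _ ≤ _ := Finset.single_le_sum (f := fun k => (c k : ℤ) * pair P x k)
        (fun k hk => mul_nonneg (by positivity) (hx k hk)) hj

theorem exists_coeff_ne_zero {i : ι} {c : ι → ℕ}
    (hc : P.coroot i = ∑ k ∈ b.support, c k • P.coroot k) : ∃ j ∈ b.support, c j ≠ 0 := by
  by_contra! h
  apply P.ne_zero' i
  rw [hc]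
  exact Finset.sum_eq_zero fun j hj => by simp [h j hj]

theorem pair_pos [Finite ι] [P.IsReduced] {x : X} (hx : IsStrictlyDominant b x) {i : ι} (hi : b.IsPos i) :
    0 < pair P x i := by
  obtain ⟨c, hc, -⟩ := exists_pair_eq_sum b hi
  obtain ⟨j, hj, hcj⟩ := exists_coeff_ne_zero b hc
  exact (hx j hj).trans_le (le_pair_of_coroot_eq_sum b hx.isDominant hc hj hcj)

end Positive

-- Words in simple reflections, the exchange property, and dominant weights as orbit representatives

section Words

variable {ι X Y : Type*} [Finite ι] [AddCommGroup X] [AddCommGroup Y] {P : RootPairing ι ℤ X Y}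
  [P.IsReduced] (b : P.Base)

omit [Finite ι] [P.IsReduced] in
theorem refl_negIndex (i : ι) : refl P (negIndex P i) = refl P i := by
  rw [negIndex, refl_weyl_smul, refl_mul_self, one_mul, refl_inv]

theorem mem_closure_simple_refl (w : P.weylGroup) :
    w ∈ Submonoid.closure (refl P '' b.support) := by
  have key (i : ι) : refl P i ∈ Submonoid.closure (refl P '' b.support) := by
    refine RootPairing.Base.induction_reflect (b := b) i
      (p := fun i => refl P i ∈ Submonoid.closure (refl P '' b.support)) ?_ ?_ ?_
    · intro i hi
      change refl P (negIndex P i) ∈ _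
      rwa [refl_negIndex]
    · exact fun i hi => Submonoid.subset_closure ⟨i, hi, rfl⟩
    · intro i j hi hj
      have hj : refl P j ∈ Submonoid.closure (refl P '' b.support) :=
        Submonoid.subset_closure ⟨j, hj, rfl⟩
      change refl P (refl P j • i) ∈ _
      rw [refl_weyl_smul, refl_inv]
      exact mul_mem (mul_mem hj hi) hj
  induction w using weyl_induction with
  | one => exact one_mem _
  | mul i w ih => exact mul_mem (key i) ih

/-- The product of the reflections in a word of root indices. -/
def wordProd (P : RootPairing ι ℤ X Y) (L : List ι) : P.weylGroup := (L.map (refl P)).prod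

omit [Finite ι] [P.IsReduced] in
theorem wordProd_cons (i : ι) (L : List ι) : wordProd P (i :: L) = refl P i * wordProd P L := by
  simp [wordProd]

omit [Finite ι] [P.IsReduced] in
theorem wordProd_concat (i : ι) (L : List ι) : wordProd P (L ++ [i]) = wordProd P L * refl P i := by
  simp [wordProd]

theorem exists_word (w : P.weylGroup) : ∃ L : List ι, (∀ i ∈ L, i ∈ b.support) ∧ wordProd P L = w := by
  induction mem_closure_simple_refl b w using Submonoid.closure_induction_left with
  | one => exact ⟨[], by simp, rfl⟩
  | mul_left x hx y _ ih =>
    obtain ⟨i, hi, rfl⟩ := hx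
    obtain ⟨L, hL, rfl⟩ := ih
    exact ⟨i :: L, by simp_all, wordProd_cons i L⟩

/-- The exchange property. Reading the word from the right, some letter $j$ makes the image of
$\alpha_i$ negative. Just before it the image is $\alpha_j$, so $s_j$ is the conjugate of $s_i$ by
the suffix, and deleting this letter amounts to multiplying by $s_i$ on the right. -/
theorem exists_shorter_word {i : ι} (hi : i ∈ b.support) (L : List ι) (hL : ∀ j ∈ L, j ∈ b.support)
    (h : ¬ b.IsPos (wordProd P L • i)) :
    ∃ L' : List ι, (∀ j ∈ L', j ∈ b.support) ∧ L'.length + 1 = L.length ∧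
      wordProd P L' = wordProd P L * refl P i := by
  induction L with
  | nil => exact absurd (isPos_simple b hi) (by simpa [wordProd] using h)
  | cons j L ih =>
    have hj : j ∈ b.support := hL j (by simp)
    have hL0 : ∀ k ∈ L, k ∈ b.support := fun k hk => hL k (by simp [hk])
    by_cases hpos : b.IsPos (wordProd P L • i)
    · have hij : wordProd P L • i = j := by
        by_contra hne
        rw [wordProd_cons, mul_smul] at h
        exact h (isPos_refl_smul b hj hpos hne)
      refine ⟨L, hL0, by simp, ?_⟩
      rw [wordProd_cons, ← hij, refl_weyl_smul]
      simp [mul_assoc, refl_mul_self]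
    · obtain ⟨L', h1, h2, h3⟩ := ih hL0 hpos
      refine ⟨j :: L', by simp_all, by simp [h2], ?_⟩
      rw [wordProd_cons, h3, wordProd_cons, mul_assoc]

/-- If $w$ kept every simple root positive, the prefix of a shortest word before its last letter $i$
would send $\alpha_i$ to a negative root. The exchange property would then give a shorter word for
$w$. -/
theorem exists_simple_inversion {w : P.weylGroup} (hw : w ≠ 1) :
    ∃ i ∈ b.support, ¬ b.IsPos (w • i) := by
  classical
  by_contra! hpos
  have hex : ∃ n, ∃ L : List ι, (∀ i ∈ L, i ∈ b.support) ∧ wordProd P L = w ∧ L.length = n := by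
    obtain ⟨L, h1, h2⟩ := exists_word b w
    exact ⟨_, L, h1, h2, rfl⟩
  obtain ⟨L, h1, h2, h3⟩ := Nat.find_spec hex
  rcases List.eq_nil_or_concat L with rfl | ⟨L', i, rfl⟩
  · exact hw h2.symm
  have hi : i ∈ b.support := h1 i (by simp)
  have h1' : ∀ j ∈ L', j ∈ b.support := fun j hj => h1 j (by simp [hj])
  rw [List.concat_eq_append, wordProd_concat] at h2
  have h4 : ¬ b.IsPos (wordProd P L' • i) := by
    have := hpos i hi
    rw [← h2, mul_smul] at this
    change b.IsPos (wordProd P L' • negIndex P i) at this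
    rwa [smul_negIndex, isPos_negIndex_iff] at this
  obtain ⟨L'', h5, h6, h7⟩ := exists_shorter_word b hi L' h1' h4
  have := Nat.find_min' hex ⟨L'', h5, h7.trans h2, rfl⟩
  simp at h3
  omega

/-- Induction on Weyl group elements along descents. -/
theorem descent_induction {q : P.weylGroup → Prop} (one : q 1)
    (step : ∀ w, ∀ i ∈ b.support, ¬ b.IsPos (w • i) → q (w * refl P i) → q w)
    (w : P.weylGroup) : q w := by
  obtain ⟨L, hL, rfl⟩ := exists_word b w
  induction hn : L.length using Nat.strong_induction_on generalizing L with
  | _ n ih =>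
    by_cases h1 : wordProd P L = 1
    · rwa [h1]
    obtain ⟨i, hi, hneg⟩ := exists_simple_inversion b h1
    obtain ⟨L', h2, h3, h4⟩ := exists_shorter_word b hi L hL hneg
    refine step _ i hi hneg ?_
    rw [← h4]
    exact ih _ (by omega) L' h2 rfl

variable {b}

theorem IsDominant.smul_eq_self {z : X} (hz : IsDominant b z) (w : P.weylGroup)
    (hw : IsDominant b (w • z)) : w • z = z := by
  induction w using descent_induction b with
  | one => simp
  | step w i hi hneg ih =>
    have h1 : pair P z i = 0 := by
      refine le_antisymm ?_ (hz i hi)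
      rw [← isPos_negIndex_iff] at hneg
      have := pair_nonneg b hw hneg
      rw [pair_negIndex, pair_weyl_smul] at this
      omega
    have h2 : refl P i • z = z := by rw [refl_smul, h1]; simp
    rw [mul_smul, h2] at ih
    exact ih hw

theorem IsStrictlyDominant.eq_one {z : X} (hz : IsStrictlyDominant b z) {w : P.weylGroup}
    (hw : IsDominant b (w • z)) : w = 1 := by
  by_contra h
  obtain ⟨i, hi, hneg⟩ := exists_simple_inversion b h
  rw [← isPos_negIndex_iff] at hneg
  have := pair_nonneg b hw hneg
  rw [pair_negIndex, pair_weyl_smul] at this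
  have := hz i hi
  omega

end Words

-- Height with respect to the positive coroots, and the order on weights

section Height

variable {ι X Y : Type*} [Finite ι] [AddCommGroup X] [AddCommGroup Y] {P : RootPairing ι ℤ X Y}
  (b : P.Base)

open Classical in
/-- The pairing of a weight with the sum of the positive coroots. -/
def posHeight (x : X) : ℤ :=
  haveI := Fintype.ofFinite ι
  ∑ i with b.IsPos i, pair P x i

theorem posHeight_add (x y : X) : posHeight b (x + y) = posHeight b x + posHeight b y := by
  simp [posHeight, pair_add, Finset.sum_add_distrib]

theorem posHeight_smul (n : ℤ) (x : X) : posHeight b (n • x) = n * posHeight b x := by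
  simp [posHeight, pair_smul, Finset.mul_sum]

theorem posHeight_sub (x y : X) : posHeight b (x - y) = posHeight b x - posHeight b y := by
  simp [posHeight, pair_sub]

variable [P.IsReduced]

/-- The simple reflection permutes the positive coroots other than $\alpha_i^\vee$. Thus simple
roots have height $2$, which makes the height strictly monotone for the order on weights. -/
theorem posHeight_refl_smul {i : ι} (hi : i ∈ b.support) (x : X) :
    posHeight b (refl P i • x) = posHeight b x - 2 * pair P x i := by
  classical
  let _ := Fintype.ofFinite ι
  have hmem : i ∈ Finset.univ.filter b.IsPos := by simpa using isPos_simple b hi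
  rw [posHeight, posHeight]
  rw [← Finset.add_sum_erase _ _ hmem, ← Finset.add_sum_erase _ _ hmem]
  have : ∑ j ∈ (Finset.univ.filter b.IsPos).erase i, pair P (refl P i • x) j =
      ∑ j ∈ (Finset.univ.filter b.IsPos).erase i, pair P x j := by
    have hmap : ∀ j ∈ (Finset.univ.filter b.IsPos).erase i,
        refl P i • j ∈ (Finset.univ.filter b.IsPos).erase i := by
      intro j hj
      simp only [Finset.mem_erase, Finset.mem_filter, Finset.mem_univ, true_and] at hj ⊢
      refine ⟨?_, isPos_refl_smul b hi hj.2 hj.1⟩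
      intro h
      have : j = negIndex P i := by
        rw [negIndex]
        nth_rewrite 2 [← h]
        rw [refl_smul_smul_index]
      rw [this, isPos_negIndex_iff] at hj
      exact hj.2 (isPos_simple b hi)
    refine Finset.sum_nbij' (fun j => refl P i • j) (fun j => refl P i • j) hmap hmap ?_ ?_ ?_
    · exact fun j _ => refl_smul_smul_index i j
    · exact fun j _ => refl_smul_smul_index i j
    · intro j _
      rw [← pair_refl_smul i j, pair_refl_smul, pair_weyl_smul_left, refl_inv]
  rw [this, refl_smul, pair_sub, pair_smul, pair_root_self]
  ring

theorem posHeight_simple {i : ι} (hi : i ∈ b.support) : posHeight b (P.root i) = 2 := by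
  have := posHeight_refl_smul b hi (P.root i)
  rw [refl_smul, pair_root_self, posHeight_sub, posHeight_smul] at this
  omega

theorem posHeight_nonneg {x : X} (hx : IsDominant b x) : 0 ≤ posHeight b x := by
  classical
  exact Finset.sum_nonneg fun i hi => pair_nonneg b hx (by simpa using hi)

variable {b}

omit [Finite ι] [P.IsReduced] in
theorem WeightLE.refl (x : X) : WeightLE b x x := by
  rw [WeightLE, sub_self]; exact zero_mem _

omit [Finite ι] [P.IsReduced] in
theorem WeightLE.trans {x y z : X} (h1 : WeightLE b x y) (h2 : WeightLE b y z) :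
    WeightLE b x z := by
  rw [WeightLE, ← sub_add_sub_cancel z y x]
  exact add_mem h2 h1

theorem WeightLE.eq_or_lt {x y : X} (h : WeightLE b x y) :
    x = y ∨ posHeight b x < posHeight b y := by
  have key : ∀ z ∈ AddSubmonoid.closure (P.root '' b.support), z = 0 ∨ 0 < posHeight b z := by
    intro z hz
    induction hz using AddSubmonoid.closure_induction with
    | mem x hx =>
      obtain ⟨i, hi, rfl⟩ := hx
      right
      rw [posHeight_simple b hi]; norm_num
    | zero => simp
    | add x y _ _ hx hy =>
      rcases hx with rfl | hx
      · simpa using hy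
      rcases hy with rfl | hy
      · right; simpa using hx
      · right; rw [posHeight_add]; omega
  rcases key _ h with h | h
  · left; exact (sub_eq_zero.1 h).symm
  · right; rw [posHeight_sub] at h; omega

theorem WeightLE.posHeight_le {x y : X} (h : WeightLE b x y) : posHeight b x ≤ posHeight b y := by
  rcases h.eq_or_lt with rfl | h
  · exact le_rfl
  · exact h.le

theorem WeightLE.antisymm {x y : X} (h1 : WeightLE b x y) (h2 : WeightLE b y x) : x = y := by
  rcases h1.eq_or_lt with h | h
  · exact h
  · exact absurd h2.posHeight_le (by omega)

omit [P.IsReduced] in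
theorem weightLE_add_smul_root (x : X) {i : ι} (hi : b.IsPos i) {n : ℤ} (hn : 0 ≤ n) :
    WeightLE b x (x + n • P.root i) := by
  rw [WeightLE, add_sub_cancel_left]
  lift n to ℕ using hn
  rw [natCast_zsmul]
  exact nsmul_mem (root_mem_closure_of_isPos b hi) n

variable (b)

theorem posHeight_root_pos {i : ι} (hi : b.IsPos i) : 0 < posHeight b (P.root i) := by
  have h := weightLE_add_smul_root (b := b) 0 hi zero_le_one
  rcases h.eq_or_lt with h | h
  · exact absurd h.symm (by simpa using P.ne_zero i)
  · simpa [posHeight, pair_zero] using h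

end Height

-- Coordinates on the weight lattice, finiteness of the Weyl group, dominant representatives

section SimplyConnected

variable {ι X Y : Type*} [AddCommGroup X] [AddCommGroup Y] {P : RootPairing ι ℤ X Y}
  [IsSimplyConnected P] (b : P.Base)

theorem eq_of_pair_eq {x y : X} (h : ∀ i ∈ b.support, pair P x i = pair P y i) : x = y := by
  apply P.toPerfPair.injective
  refine (simpleCorootBasis b).ext fun i => ?_
  have h2 : simpleCorootBasis b i = P.coroot i := by
    rw [simpleCorootBasis, Module.Basis.mk_apply]
  rw [h2]
  exact h i i.2

theorem pair_sum_fundamentalWeight (c : ι → ℤ) {i : ι} (hi : i ∈ b.support) :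
    pair P (∑ j : b.support, c j • fundamentalWeight b j) i = c i := by
  classical
  have : pair P (∑ j : b.support, c j • fundamentalWeight b j) i =
      ∑ j : b.support, c j * pair P (fundamentalWeight b j) (⟨i, hi⟩ : b.support) := by
    simp [pair]
  rw [this, Finset.sum_congr rfl fun j _ => by rw [pair_fundamentalWeight]]
  simp

theorem exists_weight (c : ι → ℤ) : ∃ x : X, ∀ i ∈ b.support, pair P x i = c i :=
  ⟨_, fun _ hi => pair_sum_fundamentalWeight b c hi⟩

theorem pair_rho {i : ι} (hi : i ∈ b.support) : pair P (rho b) i = 1 := by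
  have := pair_sum_fundamentalWeight b (fun _ => 1) hi
  simpa [rho] using this

theorem finite_of_pair_mem {s : Set X} {m M : ℤ}
    (h : ∀ x ∈ s, ∀ i ∈ b.support, m ≤ pair P x i ∧ pair P x i ≤ M) : s.Finite := by
  have hinj : Function.Injective fun (x : X) (i : b.support) => pair P x i := by
    intro x y hxy
    exact eq_of_pair_eq b fun i hi => congrFun hxy ⟨i, hi⟩
  have hfin : (Set.univ.pi fun _ : b.support => Set.Icc m M).Finite :=
    Set.Finite.pi fun _ => Set.finite_Icc m M
  refine (hfin.preimage hinj.injOn).subset ?_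
  intro x hx i _
  exact h x hx i i.2

instance finite_weylGroup [Finite ι] : Finite P.weylGroup := by
  refine Finite.of_injective (fun (w : P.weylGroup) (i : ι) => w • i) fun w w' h => ?_
  apply weyl_ext
  intro x
  have hb : ∀ i : ι, pair P (w • x) i = pair P (w' • x) i := by
    intro i
    have h1 : w • (w⁻¹ • i) = w' • (w⁻¹ • i) := congrFun h _
    rw [smul_inv_smul] at h1
    rw [pair_weyl_smul_left w]
    nth_rewrite 2 [h1]
    rw [pair_weyl_smul]
  apply P.toPerfPair.injective
  refine LinearMap.ext_on_range (v := P.coroot) IsSimplyConnected.span_coroot hb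

variable [Finite ι] [P.IsReduced]

/-- Induction along the orbits of the Weyl group, from dominant weights downwards. -/
theorem climb_induction {q : X → Prop} (dom : ∀ z, IsDominant b z → q z)
    (step : ∀ z, ∀ i ∈ b.support, pair P z i < 0 → q (refl P i • z) → q z) (x : X) : q x := by
  -- Reflecting in a simple root with negative pairing raises the height, and the height is bounded
  -- on the orbit. The induction below is on the gap to the maximum.
  obtain ⟨w₀, hw₀⟩ := Finite.exists_max fun w : P.weylGroup => posHeight b (w • x)
  have key : ∀ (n : ℕ) (w : P.weylGroup),
      posHeight b (w₀ • x) - posHeight b (w • x) ≤ n → q (w • x) := by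
    intro n
    induction n with
    | zero =>
      intro w hw
      refine dom _ fun i hi => ?_
      have := posHeight_refl_smul b hi (w • x)
      rw [← mul_smul] at this
      have h2 : posHeight b ((refl P i * w) • x) ≤ posHeight b (w₀ • x) := hw₀ (refl P i * w)
      push_cast at hw
      omega
    | succ n ih =>
      intro w hw
      by_cases hd : IsDominant b (w • x)
      · exact dom _ hd
      · simp only [IsDominant, not_forall] at hd
        obtain ⟨i, hi, hneg⟩ := hd
        refine step _ i hi (by omega) ?_
        have := posHeight_refl_smul b hi (w • x)
        rw [← mul_smul] at this ⊢
        apply ih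
        push_cast at hw
        omega
  have := key (posHeight b (w₀ • x) - posHeight b x).toNat 1 (by rw [one_smul]; omega)
  rwa [one_smul] at this

theorem exists_smul_isDominant (x : X) : ∃ w : P.weylGroup, IsDominant b (w • x) := by
  induction x using climb_induction b with
  | dom z hz => exact ⟨1, by rwa [one_smul]⟩
  | step z i _ _ ih =>
    obtain ⟨w, hw⟩ := ih
    exact ⟨w * refl P i, by rwa [mul_smul]⟩

/-- The dominant weight in the Weyl group orbit of `x`. -/
def dom (x : X) : X := (exists_smul_isDominant b x).choose • x

theorem isDominant_dom (x : X) : IsDominant b (dom b x) :=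
  (exists_smul_isDominant b x).choose_spec

theorem exists_dom_eq_smul (x : X) : ∃ w : P.weylGroup, dom b x = w • x := ⟨_, rfl⟩

theorem dom_eq_of_isDominant {x : X} (w : P.weylGroup) (hw : IsDominant b (w • x)) :
    dom b x = w • x := by
  obtain ⟨v, hv⟩ := exists_dom_eq_smul b x
  have h := hw.smul_eq_self (v * w⁻¹) (by
    rw [mul_smul, inv_smul_smul, ← hv]; exact isDominant_dom b x)
  rwa [mul_smul, inv_smul_smul, ← hv] at h

theorem dom_of_isDominant {x : X} (hx : IsDominant b x) : dom b x = x := by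
  simpa using dom_eq_of_isDominant b 1 (by simpa using hx)

theorem dom_smul (w : P.weylGroup) (x : X) : dom b (w • x) = dom b x := by
  obtain ⟨v, hv⟩ := exists_dom_eq_smul b x
  rw [hv, dom_eq_of_isDominant b (x := w • x) (v * w⁻¹)]
  · rw [mul_smul, inv_smul_smul]
  · rw [mul_smul, inv_smul_smul, ← hv]; exact isDominant_dom b x

theorem dom_eq_dom_iff {x y : X} : dom b x = dom b y ↔ ∃ w : P.weylGroup, w • x = y := by
  constructor
  · intro h
    obtain ⟨v, hv⟩ := exists_dom_eq_smul b x
    obtain ⟨u, hu⟩ := exists_dom_eq_smul b y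
    exact ⟨u⁻¹ * v, by rw [mul_smul, ← hv, h, hu, inv_smul_smul]⟩
  · rintro ⟨w, rfl⟩
    rw [dom_smul]

theorem weightLE_dom (x : X) : WeightLE b x (dom b x) := by
  induction x using climb_induction b with
  | dom z hz => rw [dom_of_isDominant b hz]; exact WeightLE.refl z
  | step z i hi hneg ih =>
    rw [dom_smul] at ih
    refine WeightLE.trans ?_ ih
    rw [refl_smul, sub_eq_add_neg, ← neg_smul]
    exact weightLE_add_smul_root z (isPos_simple b hi) (by omega)

end SimplyConnected

-- Irreducibility and the highest coroot

section Irreducible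

variable {ι X Y : Type*} [AddCommGroup X] [AddCommGroup Y] {P : RootPairing ι ℤ X Y} (b : P.Base)

theorem pairing_eq_zero_of_mem_span {J K : Set ι} (h : ∀ i ∈ J, ∀ j ∈ K, P.pairing i j = 0)
    {x : X} {y : Y} (hx : x ∈ Submodule.span ℤ (P.root '' J))
    (hy : y ∈ Submodule.span ℤ (P.coroot '' K)) : P.toLinearMap x y = 0 := by
  induction hx using Submodule.span_induction with
  | mem x hx =>
    obtain ⟨i, hi, rfl⟩ := hx
    induction hy using Submodule.span_induction with
    | mem y hy =>
      obtain ⟨j, hj, rfl⟩ := hy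
      exact h i hi j hj
    | zero => simp
    | add y z _ _ hy hz => rw [map_add, hy, hz, add_zero]
    | smul n y _ hy => rw [map_smul, hy, smul_zero]
  | zero => simp
  | add x z _ _ hx hz => rw [map_add, LinearMap.add_apply, hx, hz, add_zero]
  | smul n x _ hx => rw [map_smul, LinearMap.smul_apply, hx, smul_zero]

variable [Finite ι] [P.IsReduced]

theorem root_mem_span_or_of_orthogonal {J K : Set ι} (hJK : (b.support : Set ι) ⊆ J ∪ K)
    (h : ∀ i ∈ J, ∀ j ∈ K, P.pairing i j = 0 ∧ P.pairing j i = 0) (r : ι) :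
    (P.root r ∈ Submodule.span ℤ (P.root '' J) ∧ P.coroot r ∈ Submodule.span ℤ (P.coroot '' J)) ∨
    (P.root r ∈ Submodule.span ℤ (P.root '' K) ∧
      P.coroot r ∈ Submodule.span ℤ (P.coroot '' K)) := by
  have key : ∀ {J K : Set ι}, (∀ i ∈ J, ∀ j ∈ K, P.pairing i j = 0 ∧ P.pairing j i = 0) →
      ∀ {r j : ι}, j ∈ J ∪ K → P.root r ∈ Submodule.span ℤ (P.root '' J) →
      P.coroot r ∈ Submodule.span ℤ (P.coroot '' J) →
      P.root (refl P j • r) ∈ Submodule.span ℤ (P.root '' J) ∧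
        P.coroot (refl P j • r) ∈ Submodule.span ℤ (P.coroot '' J) := by
    intro J K h r j hj h1 h2
    rw [root_smul, refl_smul, coroot_refl_smul]
    rcases hj with hj | hj
    · exact ⟨sub_mem h1 (Submodule.smul_mem _ _ (Submodule.subset_span ⟨j, hj, rfl⟩)),
        sub_mem h2 (Submodule.smul_mem _ _ (Submodule.subset_span ⟨j, hj, rfl⟩))⟩
    · have e1 : pair P (P.root r) j = 0 :=
        pairing_eq_zero_of_mem_span (fun i hi j hj => (h i hi j hj).1) h1
          (Submodule.subset_span ⟨j, hj, rfl⟩)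
      have e2 : P.pairing j r = 0 :=
        pairing_eq_zero_of_mem_span (fun i hi j hj => (h j hj i hi).2)
          (Submodule.subset_span ⟨j, hj, rfl⟩) h2
      rw [e1, e2]
      simpa using ⟨h1, h2⟩
  refine RootPairing.Base.induction_reflect (b := b) r (p := fun r =>
    (P.root r ∈ Submodule.span ℤ (P.root '' J) ∧ P.coroot r ∈ Submodule.span ℤ (P.coroot '' J)) ∨
    (P.root r ∈ Submodule.span ℤ (P.root '' K) ∧
      P.coroot r ∈ Submodule.span ℤ (P.coroot '' K))) ?_ ?_ ?_
  · intro r hr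
    change (P.root (negIndex P r) ∈ _ ∧ P.coroot (negIndex P r) ∈ _) ∨
      (P.root (negIndex P r) ∈ _ ∧ P.coroot (negIndex P r) ∈ _)
    simpa only [root_negIndex, coroot_negIndex, neg_mem_iff] using hr
  · intro i hi
    rcases hJK hi with hi | hi
    · exact Or.inl ⟨Submodule.subset_span ⟨i, hi, rfl⟩, Submodule.subset_span ⟨i, hi, rfl⟩⟩
    · exact Or.inr ⟨Submodule.subset_span ⟨i, hi, rfl⟩, Submodule.subset_span ⟨i, hi, rfl⟩⟩
  · intro r j hr hj
    rcases hr with hr | hr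
    · exact Or.inl (key h (hJK hj) hr.1 hr.2)
    · exact Or.inr (key (fun i hi j hj => (h j hj i hi).symm) (hJK hj).symm hr.1 hr.2)

/-- Connectedness of the Dynkin diagram: an orthogonal splitting of the simple roots would spread by
reflections to a splitting of the whole root system. -/
theorem mem_of_orthogonal_compl [IsIrreducibleDatum P] {J : Set ι} (hne : J.Nonempty)
    (h : ∀ i ∈ J, ∀ j ∈ b.support, j ∉ J → P.pairing i j = 0 ∧ P.pairing j i = 0)
    {j : ι} (hj : j ∈ b.support) : j ∈ J := by
  classical
  by_contra hjJ
  set K : Set ι := {k | k ∈ b.support ∧ k ∉ J} with hK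
  have hJK : (b.support : Set ι) ⊆ J ∪ K := by
    intro k hk
    by_cases hkJ : k ∈ J
    · exact Or.inl hkJ
    · exact Or.inr ⟨hk, hkJ⟩
  have horth : ∀ i ∈ J, ∀ j ∈ K, P.pairing i j = 0 ∧ P.pairing j i = 0 :=
    fun i hi j hj => h i hi j hj.1 hj.2
  have huniv := IsIrreducibleDatum.eq_univ (P := P)
    {r | P.root r ∈ Submodule.span ℤ (P.root '' J) ∧
      P.coroot r ∈ Submodule.span ℤ (P.coroot '' J)}
    (by
      obtain ⟨i, hi⟩ := hne
      exact ⟨i, Submodule.subset_span ⟨i, hi, rfl⟩, Submodule.subset_span ⟨i, hi, rfl⟩⟩)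
    (by
      intro r hr s hs
      have hs' := (root_mem_span_or_of_orthogonal b hJK horth s).resolve_left hs
      exact ⟨pairing_eq_zero_of_mem_span (fun i hi j hj => (horth i hi j hj).1) hr.1 hs'.2,
        pairing_eq_zero_of_mem_span (fun j hj i hi => (horth i hi j hj).2) hs'.1 hr.2⟩)
  have h1 : j ∈ {r | P.root r ∈ Submodule.span ℤ (P.root '' J) ∧
      P.coroot r ∈ Submodule.span ℤ (P.coroot '' J)} := by rw [huniv]; trivial
  have h2 : P.toLinearMap (P.root j) (P.coroot j) = 0 :=
    pairing_eq_zero_of_mem_span (fun i hi j hj => (horth i hi j hj).1) h1.1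
      (Submodule.subset_span ⟨j, ⟨hj, hjJ⟩, rfl⟩)
  have := pair_root_self (P := P) j
  rw [pair, h2] at this
  norm_num at this

omit [P.IsReduced] in
theorem coroot_sub_coroot_mem {i j : ι} (h : 0 < P.pairing j i) (hij : i ≠ j) :
    ∃ k, P.coroot k = P.coroot i - P.coroot j := by
  have := P.flip.root_sub_root_mem_of_pairingIn_pos (i := i) (j := j) (by
    have h2 := P.flip.algebraMap_pairingIn ℤ i j
    simp only [algebraMap_int_eq, eq_intCast, Int.cast_id, RootPairing.pairing_flip] at h2
    rwa [h2]) hij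
  exact this

omit [P.IsReduced] in
theorem pairing_pos_iff {i j : ι} : 0 < P.pairing i j ↔ 0 < P.pairing j i := by
  have h := P.zero_lt_pairingIn_iff' (S := ℤ) (i := i) (j := j)
  have h1 := P.algebraMap_pairingIn ℤ i j
  have h2 := P.algebraMap_pairingIn ℤ j i
  simp only [algebraMap_int_eq, eq_intCast, Int.cast_id] at h1 h2
  rwa [h1, h2] at h

omit [P.IsReduced] in
theorem pairing_simple_nonpos {i j : ι} (hij : i ≠ j) (hi : i ∈ b.support) (hj : j ∈ b.support) :
    P.pairing i j ≤ 0 := by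
  have := b.pairingIn_le_zero_of_ne hij hi hj
  have h1 := P.algebraMap_pairingIn ℤ i j
  simp only [algebraMap_int_eq, eq_intCast, Int.cast_id] at h1
  rwa [h1] at this

variable [IsIrreducibleDatum P] [IsSimplyConnected P]

omit [P.IsReduced] in
theorem pair_rho_le (j : ι) : pair P (rho b) j ≤ pair P (rho b) (highestCoroot b) :=
  (exists_highest b).choose_spec j

omit [Finite ι] [P.IsReduced] [IsIrreducibleDatum P] in
theorem isStrictlyDominant_rho : IsStrictlyDominant b (rho b) := by
  intro i hi
  rw [pair_rho b hi]
  norm_num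

theorem isPos_highestCoroot : b.IsPos (highestCoroot b) := by
  by_contra h
  rw [← isPos_negIndex_iff] at h
  have h1 := pair_pos b (isStrictlyDominant_rho b) h
  have h2 := pair_rho_le b (negIndex P (highestCoroot b))
  rw [pair_negIndex] at h1 h2
  omega

omit [P.IsReduced] in
theorem pairing_highestCoroot_nonneg {i : ι} (hi : i ∈ b.support) :
    0 ≤ P.pairing i (highestCoroot b) := by
  have := pair_rho_le b (refl P i • highestCoroot b)
  rw [pair_refl_smul_index, pair_rho b hi] at this
  omega

omit [P.IsReduced] [IsIrreducibleDatum P] [IsSimplyConnected P] in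
theorem exists_root_eq_sum {i : ι} (hi : b.IsPos i) :
    ∃ c : ι → ℕ, P.root i = ∑ j ∈ b.support, c j • P.root j :=
  exists_nat_coeff (P := P.flip) (root_mem_closure_of_isPos b hi)

omit [Finite ι] [P.IsReduced] [IsIrreducibleDatum P] [IsSimplyConnected P] in
theorem pairing_eq_sum {i : ι} {c : ι → ℕ} (hc : P.root i = ∑ j ∈ b.support, c j • P.root j)
    (k : ι) : P.pairing i k = ∑ j ∈ b.support, c j * P.pairing j k := by
  rw [← pair_root, hc, pair]
  simp

/-- A simple root outside the support of $\alpha_0$ pairs nonpositively with each simple root in the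
support, and nonnegatively with $\alpha_0$ by maximality of $\alpha_0^\vee$. It is therefore
orthogonal to the support, and connectedness leaves no such simple root. -/
theorem coeff_highest_ne_zero {c : ι → ℕ}
    (hc : P.root (highestCoroot b) = ∑ j ∈ b.support, c j • P.root j)
    {j : ι} (hj : j ∈ b.support) : c j ≠ 0 := by
  have hJ : j ∈ {i : ι | i ∈ b.support ∧ c i ≠ 0} := by
    refine mem_of_orthogonal_compl b ?_ ?_ hj
    · by_contra h
      apply P.ne_zero (highestCoroot b)
      rw [hc]
      refine Finset.sum_eq_zero fun i hi => ?_
      by_contra h2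
      exact h ⟨i, hi, fun h3 => h2 (by simp [h3])⟩
    · rintro i ⟨hi, hci⟩ k hk hkJ
      have hck : c k = 0 := by
        by_contra h
        exact hkJ ⟨hk, h⟩
      have h1 : ∀ l ∈ b.support, (c l : ℤ) * P.pairing l k ≤ 0 := by
        intro l hl
        by_cases hlk : l = k
        · subst hlk; simp [hck]
        · exact mul_nonpos_of_nonneg_of_nonpos (by positivity) (pairing_simple_nonpos b hlk hl hk)
      have h2 : P.pairing (highestCoroot b) k = 0 := by
        refine le_antisymm ?_ ?_
        · rw [pairing_eq_sum b hc]
          exact Finset.sum_nonpos h1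
        · by_contra! h3
          have h4 := pairing_highestCoroot_nonneg b hk
          rcases h4.eq_or_lt with h5 | h5
          · rw [P.pairing_eq_zero_iff'.1 h5.symm] at h3
            exact lt_irrefl _ h3
          · exact absurd (pairing_pos_iff.1 h5) (by omega)
      rw [pairing_eq_sum b hc] at h2
      have h3 := (Finset.sum_eq_zero_iff_of_nonpos h1).1 h2 i hi
      have h4 : P.pairing i k = 0 := by
        rcases mul_eq_zero.1 h3 with h | h
        · exact absurd (by exact_mod_cast h) hci
        · exact h
      exact ⟨h4, P.pairing_eq_zero_iff'.1 h4⟩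
  exact hJ.2

/-- A counterexample $\alpha_j^\vee$ of greatest height pairs nonnegatively with all simple roots.
It does not pair positively with $\alpha_0$, since then $\alpha_0^\vee-\alpha_j^\vee$ would be a
coroot: a positive one contradicts the choice of $j$, a negative one the maximality of
$\alpha_0^\vee$. As all coefficients of $\alpha_0$ are positive, $\alpha_j^\vee$ is orthogonal to
every simple root, hence to $\alpha_j$, which is absurd. -/
theorem coroot_le_highestCoroot (j : ι) :
    P.coroot (highestCoroot b) - P.coroot j ∈ AddSubmonoid.closure (P.coroot '' b.support) := by
  by_contra hj
  obtain ⟨j, hj, hmax⟩ : ∃ j, P.coroot (highestCoroot b) - P.coroot j ∉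
      AddSubmonoid.closure (P.coroot '' b.support) ∧ ∀ k, P.coroot (highestCoroot b) - P.coroot k ∉
      AddSubmonoid.closure (P.coroot '' b.support) → pair P (rho b) k ≤ pair P (rho b) j := by
    have hfin : {k | P.coroot (highestCoroot b) - P.coroot k ∉
      AddSubmonoid.closure (P.coroot '' b.support)}.Finite := Set.toFinite _
    obtain ⟨j, h1, h2⟩ := Set.exists_max_image _ (fun k => pair P (rho b) k) hfin ⟨j, hj⟩
    exact ⟨j, h1, h2⟩
  have hdom : ∀ i ∈ b.support, 0 ≤ P.pairing i j := by
    intro i hi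
    by_contra! hneg
    have h1 : P.coroot (highestCoroot b) - P.coroot (refl P i • j) ∈
        AddSubmonoid.closure (P.coroot '' b.support) := by
      by_contra h
      have := hmax _ h
      rw [pair_refl_smul_index, pair_rho b hi] at this
      omega
    apply hj
    obtain ⟨n, hn⟩ := Int.eq_ofNat_of_zero_le (show 0 ≤ -P.pairing i j by omega)
    have h2 : P.coroot (highestCoroot b) - P.coroot j =
        (P.coroot (highestCoroot b) - P.coroot (refl P i • j)) + n • P.coroot i := by
      rw [coroot_refl_smul, ← natCast_zsmul, ← hn]
      module
    have h3 : P.coroot i ∈ AddSubmonoid.closure (P.coroot '' b.support) :=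
      AddSubmonoid.subset_closure ⟨i, hi, rfl⟩
    rw [h2]
    exact add_mem h1 (nsmul_mem h3 n)
  have hne : highestCoroot b ≠ j := by
    intro h
    apply hj
    rw [h, sub_self]
    exact zero_mem _
  have hnp : P.pairing (highestCoroot b) j ≤ 0 := by
    by_contra! hpos
    obtain ⟨k, hk⟩ := coroot_sub_coroot_mem (pairing_pos_iff.1 hpos) hne
    by_cases hkpos : b.IsPos k
    · apply hj
      rw [← hk]
      exact coroot_mem_closure_of_isPos b hkpos
    · rw [← isPos_negIndex_iff] at hkpos
      have h1 := pair_pos b (isStrictlyDominant_rho b) hkpos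
      have h2 := pair_rho_le b j
      rw [pair_negIndex, pair, hk] at h1
      simp only [map_sub] at h1
      change 0 < -(pair P (rho b) _ - pair P (rho b) _) at h1
      omega
  obtain ⟨c, hc⟩ := exists_root_eq_sum b (isPos_highestCoroot b)
  have hnonneg : ∀ i ∈ b.support, 0 ≤ (c i : ℤ) * P.pairing i j :=
    fun i hi => mul_nonneg (by positivity) (hdom i hi)
  have hzero : ∑ i ∈ b.support, (c i : ℤ) * P.pairing i j = 0 :=
    le_antisymm (by rwa [← pairing_eq_sum b hc]) (Finset.sum_nonneg hnonneg)
  have hz : ∀ i ∈ b.support, P.pairing i j = 0 := by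
    intro i hi
    rcases mul_eq_zero.1 ((Finset.sum_eq_zero_iff_of_nonneg hnonneg).1 hzero i hi) with h | h
    · exact absurd (by exact_mod_cast h) (coeff_highest_ne_zero b hc hi)
    · exact h
  have hall : ∀ k, b.IsPos k → P.pairing k j = 0 := by
    intro k hk
    obtain ⟨d, hd⟩ := exists_root_eq_sum b hk
    rw [pairing_eq_sum b hd]
    exact Finset.sum_eq_zero fun i hi => by rw [hz i hi, mul_zero]
  by_cases hjpos : b.IsPos j
  · have := hall j hjpos
    rw [P.pairing_same] at this
    norm_num at this
  · rw [← isPos_negIndex_iff] at hjpos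
    have := hall _ hjpos
    rw [← pair_root, root_negIndex, pair_neg, pair_root_self] at this
    norm_num at this

theorem pair_le_highestCoroot {x : X} (hx : IsDominant b x) (j : ι) :
    pair P x j ≤ pair P x (highestCoroot b) := by
  obtain ⟨c, hc⟩ := exists_nat_coeff (coroot_le_highestCoroot b j)
  have h : pair P x (highestCoroot b) - pair P x j = ∑ i ∈ b.support, c i * pair P x i := by
    have := congrArg (P.toLinearMap x) hc
    simpa [pair] using this
  have h2 : 0 ≤ ∑ i ∈ b.support, c i * pair P x i :=
    Finset.sum_nonneg fun i hi => mul_nonneg (by positivity) (hx i hi)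
  omega

omit [P.IsReduced] in
theorem WeightLE.pair_highestCoroot_le {x y : X} (h : WeightLE b x y) :
    pair P x (highestCoroot b) ≤ pair P y (highestCoroot b) := by
  have key : ∀ z ∈ AddSubmonoid.closure (P.root '' b.support), 0 ≤ pair P z (highestCoroot b) := by
    intro z hz
    induction hz using AddSubmonoid.closure_induction with
    | mem z hz =>
      obtain ⟨i, hi, rfl⟩ := hz
      exact pairing_highestCoroot_nonneg b hi
    | zero => rw [pair_zero]
    | add z w _ _ hz hw => rw [pair_add]; omega
  have := key _ h
  rw [pair_sub] at this
  omega

/-- The weights below a dominant weight pair with every coroot at most as the dominant weight pairs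
with the highest coroot. -/
theorem pair_le_of_dom_le {x lam : X} (h : WeightLE b (dom b x) lam) (i : ι) :
    pair P x i ≤ pair P lam (highestCoroot b) := by
  obtain ⟨w, hw⟩ := exists_dom_eq_smul b x
  rw [← pair_weyl_smul w, ← hw]
  exact (pair_le_highestCoroot b (isDominant_dom b x) _).trans h.pair_highestCoroot_le

end Irreducible

-- Affine reflections and the separation preorder

section AffineReflections

variable {ι X Y : Type*} [AddCommGroup X] [AddCommGroup Y] {P : RootPairing ι ℤ X Y} (p : ℕ)

/-- The affine reflection `s_{α,np}`. -/
def affRefl (P : RootPairing ι ℤ X Y) (p : ℕ) (i : ι) (n : ℤ) (x : X) : X :=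
  x - (pair P x i - n * p) • P.root i

theorem affRefl_zero (i : ι) (x : X) : affRefl P p i 0 x = refl P i • x := by
  rw [affRefl, refl_smul]; simp

theorem affRefl_negIndex (i : ι) (n : ℤ) (x : X) :
    affRefl P p (negIndex P i) (-n) x = affRefl P p i n x := by
  rw [affRefl, affRefl, root_negIndex, pair_negIndex]
  module

theorem pair_affRefl (i j : ι) (n : ℤ) (x : X) :
    pair P (affRefl P p i n x) j = pair P x j - (pair P x i - n * p) * P.pairing i j := by
  rw [affRefl, pair_sub, pair_smul, pair_root]

theorem smul_affRefl (w : P.weylGroup) (i : ι) (n : ℤ) (x : X) :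
    w • affRefl P p i n x = affRefl P p (w • i) n (w • x) := by
  rw [affRefl, affRefl, smul_sub, smul_zsmul, root_smul, pair_weyl_smul]

theorem affRefl_affRefl (i : ι) (n : ℤ) (x : X) : affRefl P p i n (affRefl P p i n x) = x := by
  rw [affRefl, pair_affRefl, P.pairing_same, affRefl]
  module

theorem pair_affRefl_refl_smul (i j : ι) (n k : ℤ) (x : X) :
    pair P (affRefl P p j k x) (refl P j • i) - (n - k * P.pairing j i) * p =
      pair P x i - n * p := by
  rw [pair_refl_smul_index, pair_affRefl, pair_affRefl, P.pairing_same]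
  ring

theorem affRefl_conj (i j : ι) (n k : ℤ) (x : X) :
    affRefl P p j k (affRefl P p i n x) =
      affRefl P p (refl P j • i) (n - k * P.pairing j i) (affRefl P p j k x) := by
  rw [affRefl.eq_def P p (refl P j • i), pair_affRefl_refl_smul, affRefl.eq_def P p j k (affRefl P p i n x),
    pair_affRefl, root_smul, refl_smul, pair_root, affRefl, affRefl]
  module

/-- `y` is obtained from `x` by an affine reflection in a hyperplane that strictly separates `y`
from `0` and from `x`. -/
def SepStep (P : RootPairing ι ℤ X Y) (p : ℕ) (x y : X) : Prop :=
  ∃ i, ∃ n : ℤ, 0 < n ∧ pair P x i < n * p ∧ y = affRefl P p i n x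

theorem SepStep.smul {x y : X} (h : SepStep P p x y) (w : P.weylGroup) :
    SepStep P p (w • x) (w • y) := by
  obtain ⟨i, n, hn, hlt, rfl⟩ := h
  exact ⟨w • i, n, hn, by rwa [pair_weyl_smul], smul_affRefl p w i n x⟩

/-- The preorder on weights generated by `SepStep` and the Weyl group orbits. -/
def SepLE (P : RootPairing ι ℤ X Y) (p : ℕ) : X → X → Prop :=
  Relation.ReflTransGen fun x y => SepStep P p x y ∨ ∃ w : P.weylGroup, y = w • x

variable {p}

theorem SepLE.of_step {x y : X} (h : SepStep P p x y) : SepLE P p x y :=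
  .single (.inl h)

theorem SepLE.of_smul (w : P.weylGroup) (x : X) : SepLE P p x (w • x) :=
  .single (.inr ⟨w, rfl⟩)

theorem SepLE.smul_left {x y : X} (h : SepLE P p x y) (w : P.weylGroup) : SepLE P p (w • x) y :=
  .head (.inr ⟨w⁻¹, by rw [inv_smul_smul]⟩) h

theorem SepLE.exists_step {x y : X} (h : SepLE P p x y) (hne : ∀ w : P.weylGroup, y ≠ w • x) :
    ∃ w : P.weylGroup, ∃ z, SepStep P p (w • x) z ∧ SepLE P p z y := by
  induction h using Relation.ReflTransGen.head_induction_on with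
  | refl => exact absurd (one_smul _ y).symm (hne 1)
  | head hstep hle ih =>
    rename_i x z
    rcases hstep with hstep | ⟨w, rfl⟩
    · exact ⟨1, z, by rwa [one_smul], hle⟩
    · obtain ⟨v, z, h1, h2⟩ := ih fun v hv => hne (v * w) (by rw [hv, mul_smul])
      exact ⟨v * w, z, by rwa [mul_smul], h2⟩

end AffineReflections

-- The order $\uparrow$ centred at $-\rho$, and its comparison with separating reflections

section Up

variable {ι X Y : Type*} [Finite ι] [AddCommGroup X] [AddCommGroup Y] {P : RootPairing ι ℤ X Y}
  [P.IsReduced] [IsSimplyConnected P] (b : P.Base) (p : ℕ)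

/-- The order `↑` in coordinates centred at `-ρ`. -/
def Up : X → X → Prop :=
  Relation.ReflTransGen fun x y => ∃ i, b.IsPos i ∧ ∃ n : ℤ, y = affRefl P p i n x ∧ WeightLE b x y

theorem upArrow_iff (x y : X) : UpArrow b p (x - rho b) (y - rho b) ↔ Up b p x y := by
  constructor
  · intro h
    have key : ∀ z z', UpArrow b p z z' → Up b p (z + rho b) (z' + rho b) := by
      intro z z' h
      refine Relation.ReflTransGen.lift (fun z : X => z + rho b) ?_ _ _ h
      rintro z z' ⟨i, hi, n, rfl, hle⟩
      refine ⟨i, hi, n, by rw [affRefl, dotAffineReflection]; module, ?_⟩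
      simpa [WeightLE] using hle
    simpa using key _ _ h
  · intro h
    refine Relation.ReflTransGen.lift (fun z : X => z - rho b) ?_ _ _ h
    rintro z z' ⟨i, hi, n, rfl, hle⟩
    refine ⟨i, hi, n, by simp [affRefl, dotAffineReflection], ?_⟩
    simpa [WeightLE] using hle

variable {b p}

omit [Finite ι] [P.IsReduced] [IsSimplyConnected P] in
theorem Up.weightLE {x y : X} (h : Up b p x y) : WeightLE b x y := by
  induction h with
  | refl => exact WeightLE.refl x
  | tail _ h ih =>
    obtain ⟨i, hi, n, rfl, hle⟩ := h
    exact ih.trans hle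

omit [P.IsReduced] [IsSimplyConnected P] in
theorem Up.affRefl {i : ι} (hi : b.IsPos i) {n : ℤ} {x : X} (h : pair P x i ≤ n * p) :
    Up b p x (affRefl P p i n x) := by
  refine .single ⟨i, hi, n, rfl, ?_⟩
  rw [SteinbergMult.affRefl, sub_eq_add_neg, ← neg_smul]
  exact weightLE_add_smul_root x hi (by omega)

theorem up_dom (x : X) : Up b p x (dom b x) := by
  induction x using climb_induction b with
  | dom z hz => rw [dom_of_isDominant b hz]; exact .refl
  | step z i hi hneg ih =>
    rw [dom_smul] at ih
    refine Relation.ReflTransGen.trans ?_ ih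
    rw [← affRefl_zero p]
    exact Up.affRefl (isPos_simple b hi) (by omega)

omit [P.IsReduced] [IsSimplyConnected P] in
-- The translation is a product of two parallel reflections. Taking the first wall within distance
-- $p$ above $x$ makes both of them go upwards.
theorem up_add_smul_root (hp : 0 < p) {i : ι} (hi : b.IsPos i) {n : ℤ} (hn : 0 < n) {x : X} :
    Up b p x (x + (n * p) • P.root i) := by
  have hp' : (0 : ℤ) < p := by exact_mod_cast hp
  set c := pair P x i with hc
  obtain ⟨k, hk1, hk2⟩ : ∃ k : ℤ, c ≤ k * p ∧ k * p ≤ c + p := by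
    refine ⟨c / p + 1, ?_, ?_⟩
    · have := Int.lt_ediv_add_one_mul_self c hp'
      omega
    · have := Int.ediv_mul_le c hp'.ne'
      linarith [add_mul (c / p) 1 (p : ℤ)]
  have h1 : Up b p x (SteinbergMult.affRefl P p i k x) := Up.affRefl hi hk1
  have h2 : Up b p (SteinbergMult.affRefl P p i k x)
      (SteinbergMult.affRefl P p i (k + n) (SteinbergMult.affRefl P p i k x)) := by
    apply Up.affRefl hi
    rw [pair_affRefl, P.pairing_same, ← hc]
    nlinarith
  have h3 : SteinbergMult.affRefl P p i (k + n) (SteinbergMult.affRefl P p i k x) =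
      x + (n * p) • P.root i := by
    rw [SteinbergMult.affRefl, pair_affRefl, P.pairing_same, SteinbergMult.affRefl]
    module
  rw [← h3]
  exact Relation.ReflTransGen.trans h1 h2

/-- Conjugate so that the lower weight is dominant. If the root of the reflection is then positive,
the step itself goes up. If it is negative, reflecting the result in the linear wall gives the
translate of the dominant weight by $np$ times the opposite, positive root. -/
theorem SepStep.up_dom (hp : 0 < p) {x y : X} (h : SepStep P p x y) :
    Up b p (dom b x) (dom b y) ∧ dom b x ≠ dom b y := by
  suffices ∃ z, dom b z = dom b y ∧ Up b p (dom b x) z ∧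
      posHeight b (dom b x) < posHeight b z by
    obtain ⟨z, hz, hup, hlt⟩ := this
    rw [← hz]
    refine ⟨Relation.ReflTransGen.trans hup (SteinbergMult.up_dom z), fun he => ?_⟩
    have := (weightLE_dom b z).posHeight_le
    rw [← he] at this
    omega
  obtain ⟨w, hw⟩ := exists_dom_eq_smul b x
  obtain ⟨i, n, hn, hlt, hy⟩ := h.smul p w
  rw [← hw] at hlt hy
  have hp' : (0 : ℤ) < p := by exact_mod_cast hp
  by_cases hi : b.IsPos i
  · refine ⟨w • y, dom_smul b w y, ?_, ?_⟩
    · rw [hy]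
      exact Up.affRefl hi hlt.le
    · rw [hy, affRefl, posHeight_sub, posHeight_smul]
      nlinarith [posHeight_root_pos b hi]
  · rw [← isPos_negIndex_iff] at hi
    have hz : refl P (negIndex P i) • w • y = dom b x + (n * p) • P.root (negIndex P i) := by
      rw [hy, refl_smul, pair_affRefl, affRefl, ← pair_root, root_negIndex, pair_negIndex,
        pair_negIndex, pair_root_self]
      module
    refine ⟨refl P (negIndex P i) • w • y, by rw [dom_smul, dom_smul], ?_, ?_⟩
    · rw [hz]
      exact up_add_smul_root hp hi hn
    · rw [hz, posHeight_add, posHeight_smul]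
      have := posHeight_root_pos b hi
      have : 0 < (n * p) * posHeight b (P.root (negIndex P i)) := by positivity
      omega

theorem SepLE.up_dom (hp : 0 < p) {x y : X} (h : SepLE P p x y) : Up b p (dom b x) (dom b y) := by
  induction h with
  | refl => exact .refl
  | tail _ h ih =>
    rcases h with h | ⟨w, rfl⟩
    · exact Relation.ReflTransGen.trans ih (h.up_dom hp).1
    · rwa [dom_smul]

end Up

-- Folding chains along an involution

section Fold

/-- Folding along an involution `r` preserving a relation `E`: chains that may cross from the
negative to the positive side are folded to chains that may cross in the other direction. -/
theorem reflTransGen_fold {α : Type*} {E : α → α → Prop} {r : α → α} {pos : α → Prop} 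
    [DecidablePred pos] (hr : ∀ x, r (r x) = x) (hE : ∀ x y, E x y → E (r x) (r y))
    (hpos : ∀ x, ¬ pos x → pos (r x) ∧ r x ≠ x) {x y : α}
    (h : Relation.ReflTransGen (fun x y => E x y ∨ (¬ pos x ∧ y = r x)) x y) :
    Relation.ReflTransGen (fun x y => E x y ∨ (pos x ∧ r x ≠ x ∧ y = r x))
      (if pos x then x else r x) (if pos y then y else r y) := by
  induction h with
  | refl => exact .refl
  | tail _ h ih =>
    rename_i y z _
    refine ih.trans ?_
    rcases h with h | ⟨hy, rfl⟩
    · by_cases hy : pos y <;> by_cases hz : pos z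
      · simp only [hy, hz, if_true]
        exact .single (Or.inl h)
      · simp only [hy, hz, if_true, if_false]
        -- A point fixed by `r` needs no extra crossing, because the image of the edge under `r`
        -- already starts there.
        by_cases hry : r y = y
        · refine .single (Or.inl ?_)
          have := hE _ _ h
          rwa [hry] at this
        · exact .head (Or.inr ⟨hy, hry, rfl⟩) (.single (Or.inl (hE _ _ h)))
      · simp only [hy, hz, if_true, if_false]
        refine .head (b := y) (Or.inr ⟨(hpos y hy).1, ?_, (hr y).symm⟩) (.single (Or.inl h))
        rw [hr]
        exact (hpos y hy).2.symm
      · simp only [hy, hz, if_false]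
        exact .single (Or.inl (hE _ _ h))
    · simp only [hy, (hpos y hy).1, if_true, if_false]
      exact .refl

end Fold

-- Moving a base point along a line: $\uparrow$ agrees with the separation preorder

section LineOrders

variable {ι X Y : Type*} [Finite ι] [AddCommGroup X] [AddCommGroup Y] {P : RootPairing ι ℤ X Y}
  (b : P.Base)

/-- Distinct powers of a transcendental number are independent over $\mathbb{Z}$. Injectivity
ensures that the line $-t\xi$ meets the reflection hyperplanes away from $0$ one at a time. -/
theorem exists_generic_functional [IsSimplyConnected P] :
    ∃ ξ : Y →ₗ[ℤ] ℝ, Function.Injective ξ ∧ ∀ i ∈ b.support, 0 < ξ (P.coroot i) := by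
  -- Squaring keeps the number transcendental and makes it visibly nonnegative.
  have hτ := (transcendental_liouvilleNumber (m := 2) le_rfl).pow (n := 2) (by norm_num)
  set τ : ℝ := liouvilleNumber ((2 : ℕ) : ℝ) ^ 2 with hτdef
  have hpos : 0 < τ := by
    refine lt_of_le_of_ne (sq_nonneg _) fun h => ?_
    rw [← h] at hτ
    exact hτ isAlgebraic_zero
  let e := Fintype.equivFin b.support
  refine ⟨(simpleCorootBasis b).constr ℤ fun j => τ ^ (e j : ℕ), ?_, ?_⟩
  · rw [injective_iff_map_eq_zero]
    intro y hy
    rw [Module.Basis.constr_apply_fintype] at hy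
    set q : Polynomial ℤ := ∑ j, Polynomial.monomial (e j : ℕ) ((simpleCorootBasis b).equivFun y j)
      with hq
    have h0 : q = 0 := by
      refine transcendental_iff.1 hτ q ?_
      rw [hq, map_sum, ← hy]
      refine Finset.sum_congr rfl fun j _ => ?_
      rw [Polynomial.aeval_monomial]
      simp
    apply (simpleCorootBasis b).equivFun.injective
    ext j
    have := congrArg (fun q => Polynomial.coeff q (e j)) h0
    simp only [hq, Polynomial.finsetSum_coeff, Polynomial.coeff_monomial] at this
    rw [Finset.sum_eq_single_of_mem j (Finset.mem_univ j)] at this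
    · simpa using this
    · intro k _ hk
      rw [if_neg]
      intro h
      exact hk (e.injective (Fin.ext h))
  · intro i hi
    have h2 : simpleCorootBasis b ⟨i, hi⟩ = P.coroot i := by
      rw [simpleCorootBasis, Module.Basis.mk_apply]
    rw [← h2, Module.Basis.constr_basis]
    positivity

/-- Reflections of `x` in hyperplanes that do not separate `x` from the point `-tξ`. -/
def LineStep (P : RootPairing ι ℤ X Y) (p : ℕ) (ξ : Y →ₗ[ℤ] ℝ) (t : ℝ) (x y : X) : Prop :=
  ∃ i, ∃ n : ℤ, y = affRefl P p i n x ∧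
    0 < ((pair P x i - n * p : ℤ) : ℝ) * (-t * ξ (P.coroot i) - n * p)

/-- The preorder generated by `LineStep`. -/
def LineLE (P : RootPairing ι ℤ X Y) (p : ℕ) (ξ : Y →ₗ[ℤ] ℝ) (t : ℝ) : X → X → Prop :=
  Relation.ReflTransGen (LineStep P p ξ t)

variable {b} {p : ℕ} {ξ : Y →ₗ[ℤ] ℝ}

theorem exists_zero_of_sign_change {a c d s t : ℝ} (hst : s ≤ t) (ht : 0 < a * (-t * c - d))
    (hs : a * (-s * c - d) ≤ 0) : ∃ u, s ≤ u ∧ u < t ∧ u * c = -d := by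
  have hcont : ContinuousOn (fun u : ℝ => a * (-u * c - d)) (Set.Icc s t) := by fun_prop
  obtain ⟨u, hu, h0⟩ := intermediate_value_Icc hst hcont ⟨hs, ht.le⟩
  have ha : a ≠ 0 := by rintro rfl; simp at ht
  have h0' : a * (-u * c - d) = 0 := h0
  have hu0 : -u * c - d = 0 := (mul_eq_zero.1 h0').resolve_left ha
  refine ⟨u, hu.1, lt_of_le_of_ne hu.2 ?_, by linarith⟩
  rintro rfl
  rw [hu0] at ht
  simp at ht

omit [Finite ι] in
theorem LineStep.of_no_zero {s t : ℝ} (hst : s ≤ t) {i : ι} {n : ℤ} {x : X}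
    (hn : ∀ u, s ≤ u → u < t → u * ξ (P.coroot i) ≠ -(n * p))
    (h : 0 < ((pair P x i - n * p : ℤ) : ℝ) * (-t * ξ (P.coroot i) - n * p)) :
    LineStep P p ξ s x (affRefl P p i n x) := by
  refine ⟨i, n, rfl, ?_⟩
  by_contra! hle
  obtain ⟨u, h1, h2, h3⟩ := exists_zero_of_sign_change hst h hle
  exact hn u h1 h2 h3

-- When the base point lies on the wall of $s_{j,kp}$, this reflection fixes it and so preserves
-- "same side as the base point". This is the invariance required for folding.
omit [Finite ι] in
theorem LineStep.affRefl {t : ℝ} {j : ι} {k : ℤ} (hj : -t * ξ (P.coroot j) = k * p) {x y : X}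
    (h : LineStep P p ξ t x y) : LineStep P p ξ t (affRefl P p j k x) (affRefl P p j k y) := by
  obtain ⟨i, n, rfl, h⟩ := h
  refine ⟨refl P j • i, n - k * P.pairing j i, affRefl_conj p i j n k x, ?_⟩
  rw [pair_affRefl_refl_smul, coroot_refl_smul]
  convert h using 2
  rw [map_sub, map_smul, zsmul_eq_mul]
  push_cast
  linear_combination (-(P.pairing j i : ℝ)) * hj

/-- The hyperplane crossed by the line at a critical time. -/
theorem eq_or_eq_negIndex_of_critical [P.IsReduced] (hξ : Function.Injective ξ) (hp : 0 < p)
    {t : ℝ} (ht : 0 < t)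
    {i j : ι} {n k : ℤ} (hk : k ≠ 0) (hi : -t * ξ (P.coroot i) = n * p)
    (hj : -t * ξ (P.coroot j) = k * p) : (i = j ∧ n = k) ∨ (i = negIndex P j ∧ n = -k) := by
  have : Module.IsReflexive ℤ X := .of_isPerfPair P.toLinearMap
  have : Module.IsReflexive ℤ Y := .of_isPerfPair P.flip.toLinearMap
  have hp' : (p : ℝ) ≠ 0 := by positivity
  have hdep : k • P.coroot i + (-n) • P.coroot j = 0 := by
    apply hξ
    rw [map_add, map_smul, map_smul, map_zero, zsmul_eq_mul, zsmul_eq_mul]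
    have : (-t) * ((k : ℝ) * ξ (P.coroot i) + ((-n : ℤ) : ℝ) * ξ (P.coroot j)) = 0 := by
      push_cast
      linear_combination (k : ℝ) * hi - n * hj
    exact (mul_eq_zero.1 this).resolve_left (by linarith)
  by_cases hij : i = j
  · subst hij
    left
    refine ⟨rfl, ?_⟩
    have : (n : ℝ) * p = k * p := hi.symm.trans hj
    exact_mod_cast mul_right_cancel₀ hp' this
  · right
    have hneg : P.coroot i = -P.coroot j := by
      by_contra h
      have := RootPairing.IsReduced.linearIndependent P.flip hij h
      exact hk (LinearIndependent.pair_iff.1 this k (-n) hdep).1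
    have hi' : i = negIndex P j := by
      apply P.coroot.injective
      rw [hneg, coroot_negIndex]
    refine ⟨hi', ?_⟩
    rw [hneg, map_neg] at hi
    have : (n : ℝ) * p = ((-k : ℤ) : ℝ) * p := by push_cast; linarith
    exact_mod_cast mul_right_cancel₀ hp' this

variable (P p ξ) in
/-- The times at which the line `-tξ` meets a reflection hyperplane not through the origin. -/
def criticalTimes : Set ℝ := {t | ∃ i, ∃ n : ℤ, n ≠ 0 ∧ t * ξ (P.coroot i) = -(n * p)}

/-- As the base point crosses a single wall, only the reflection in that wall changes its allowed
direction. All other steps are also steps for the base point on the wall, so folding reverses the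
crossings. Dominant endpoints lie on the positive side, since the wall has $k<0$, and are left in
place. -/
theorem lineLE_of_critical [P.IsReduced] (hξ : Function.Injective ξ) (hp : 0 < p)
    (hpos : ∀ i, b.IsPos i → 0 < ξ (P.coroot i)) {s t u : ℝ} (hs : 0 < s) (hst : s < t)
    (htu : t < u) (htc : t ∈ criticalTimes P p ξ)
    (h1 : ∀ v ∈ criticalTimes P p ξ, s ≤ v → v < t → False)
    (h2 : ∀ v ∈ criticalTimes P p ξ, t < v → v < u → False)
    {x y : X} (hx : IsDominant b x) (hy : IsDominant b y) (h : LineLE P p ξ u x y) :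
    LineLE P p ξ s x y := by
  classical
  have ht : 0 < t := hs.trans hst
  have hp' : (0 : ℝ) < p := by exact_mod_cast hp
  have hne (i : ι) : ξ (P.coroot i) ≠ 0 := by
    rw [← map_zero ξ]
    exact fun h => P.ne_zero' i (hξ h)
  have hnzero {i : ι} {n : ℤ} {v : ℝ} (hv : 0 < v) (h : v * ξ (P.coroot i) = -(n * p)) :
      n ≠ 0 := by
    rintro rfl
    simp [hv.ne', hne i] at h
  obtain ⟨j, k, hj, hk, htj⟩ : ∃ j, ∃ k : ℤ, b.IsPos j ∧ k < 0 ∧ -t * ξ (P.coroot j) = k * p := by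
    obtain ⟨i, n, hn, hi⟩ := htc
    have aux : ∀ i, ∀ n : ℤ, b.IsPos i → -t * ξ (P.coroot i) = n * p → n < 0 := by
      intro i n hi h
      have h3 := hpos i hi
      have h4 : (n : ℝ) * p < 0 := by rw [← h]; nlinarith
      have h5 : (n : ℝ) < 0 := by
        by_contra! h6
        nlinarith
      exact_mod_cast h5
    by_cases hipos : b.IsPos i
    · have : -t * ξ (P.coroot i) = n * p := by linarith
      exact ⟨i, n, hipos, aux i n hipos this, this⟩
    · rw [← isPos_negIndex_iff] at hipos
      have : -t * ξ (P.coroot (negIndex P i)) = ((-n : ℤ) : ℝ) * p := by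
        rw [coroot_negIndex, map_neg]; push_cast; linarith
      exact ⟨_, -n, hipos, aux _ _ hipos this, this⟩
  have hpos_dom : ∀ z, IsDominant b z → k * p ≤ pair P z j := by
    intro z hz
    have h3 := pair_nonneg b hz hj
    have h4 : k * (p : ℤ) ≤ 0 := mul_nonpos_of_nonpos_of_nonneg hk.le (by positivity)
    omega
  have hξj := hpos j hj
  have hpr (z : X) : pair P (affRefl P p j k z) j = 2 * (k * p) - pair P z j := by
    rw [pair_affRefl, P.pairing_same]; ring
  have hfold := reflTransGen_fold (E := LineStep P p ξ t) (r := affRefl P p j k)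
    (pos := fun z => k * p ≤ pair P z j) (x := x) (y := y) (affRefl_affRefl p j k)
    (fun z z' hz => hz.affRefl htj)
    (fun z hz => by
      refine ⟨by rw [hpr]; omega, fun h => ?_⟩
      have := hpr z
      rw [h] at this
      omega)
    (by
      refine Relation.ReflTransGen.mono ?_ _ _ h
      rintro z z' ⟨i, n, rfl, hpos'⟩
      by_cases hit : -t * ξ (P.coroot i) = n * p
      · right
        -- For time `u` the base point is on the negative side of the critical wall, so this
        -- reflection can only start from the negative side.
        have hu : -u * ξ (P.coroot j) - k * p < 0 := by nlinarith
        rcases eq_or_eq_negIndex_of_critical hξ hp ht hk.ne hit htj with ⟨rfl, rfl⟩ | ⟨rfl, rfl⟩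
        · refine ⟨?_, rfl⟩
          intro h
          have : (0 : ℝ) ≤ ((pair P z i - n * p : ℤ) : ℝ) := by exact_mod_cast (by omega)
          nlinarith
        · rw [affRefl_negIndex]
          refine ⟨?_, rfl⟩
          intro h
          rw [pair_negIndex, coroot_negIndex, map_neg] at hpos'
          have : (0 : ℝ) ≤ ((pair P z j - k * p : ℤ) : ℝ) := by exact_mod_cast (by omega)
          push_cast at hpos' this
          nlinarith
      · left
        refine LineStep.of_no_zero htu.le (fun v hv1 hv2 hv => ?_) hpos'
        rcases hv1.eq_or_lt with rfl | hv1
        · exact hit (by linarith)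
        · exact h2 v ⟨i, n, hnzero (ht.trans hv1) hv, hv⟩ hv1 hv2)
  rw [if_pos (hpos_dom x hx), if_pos (hpos_dom y hy)] at hfold
  refine Relation.ReflTransGen.mono ?_ _ _ hfold
  rintro z z' (⟨i, n, rfl, hpos'⟩ | ⟨hz, hne', rfl⟩)
  · exact LineStep.of_no_zero hst.le
      (fun v hv1 hv2 hv => h1 v ⟨i, n, hnzero (hs.trans_le hv1) hv, hv⟩ hv1 hv2) hpos'
  · refine ⟨j, k, rfl, mul_pos ?_ (by nlinarith)⟩
    have : k * p ≠ pair P z j := by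
      intro h
      apply hne'
      rw [affRefl, ← h]
      simp
    exact_mod_cast (by omega)

theorem finite_criticalTimes (hne : ∀ i, ξ (P.coroot i) ≠ 0) (hp : 0 < p) (s t : ℝ) :
    (criticalTimes P p ξ ∩ Set.Ioo s t).Finite := by
  have hp' : (0 : ℝ) < p := by exact_mod_cast hp
  have hfin : (⋃ i : ι, (fun n : ℤ => -(n * p) / ξ (P.coroot i)) ''
      (Set.Icc ⌊-(max |s| |t| * |ξ (P.coroot i)| / p)⌋
        ⌈max |s| |t| * |ξ (P.coroot i)| / p⌉)).Finite :=
    Set.finite_iUnion fun i => (Set.finite_Icc _ _).image _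
  refine hfin.subset ?_
  rintro u ⟨⟨i, n, -, hu⟩, hsu, hut⟩
  have hξi := hne i
  refine Set.mem_iUnion.2 ⟨i, n, ?_, (div_eq_iff hξi).2 hu.symm⟩
  have habs : |u| ≤ max |s| |t| := abs_le_max_abs_abs hsu.le hut.le
  have hn : |(n : ℝ)| ≤ max |s| |t| * |ξ (P.coroot i)| / p := by
    rw [le_div_iff₀ hp']
    have h3 : |(n : ℝ)| * p = |u| * |ξ (P.coroot i)| := by
      rw [← abs_mul, hu, abs_neg, abs_mul, abs_of_pos hp']
    rw [h3]
    gcongr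
  have h4 := abs_le.1 hn
  refine ⟨?_, ?_⟩
  · have := (Int.floor_le _).trans h4.1
    exact_mod_cast this
  · have := h4.2.trans (Int.le_ceil _)
    exact_mod_cast this

/-- Induction on the number of critical times between $s$ and $t$. The last of them is crossed by
moving to a time just before it. -/
theorem lineLE_of_lineLE [P.IsReduced] (hξ : Function.Injective ξ) (hp : 0 < p)
    (hpos : ∀ i, b.IsPos i → 0 < ξ (P.coroot i)) {s : ℝ} (hs : 0 < s)
    (hsc : ∀ v ∈ criticalTimes P p ξ, 0 < v → s < v) {x y : X} (hx : IsDominant b x)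
    (hy : IsDominant b y) {t : ℝ} (hst : s < t) (h : LineLE P p ξ t x y) : LineLE P p ξ s x y := by
  have hne (i : ι) : ξ (P.coroot i) ≠ 0 := by
    rw [← map_zero ξ]
    exact fun h => P.ne_zero' i (hξ h)
  have hnzero {i : ι} {n : ℤ} {v : ℝ} (hv : 0 < v) (h : v * ξ (P.coroot i) = -(n * p)) :
      n ≠ 0 := by
    rintro rfl
    simp [hv.ne', hne i] at h
  induction hN : (criticalTimes P p ξ ∩ Set.Ioo s t).ncard using Nat.strong_induction_on
    generalizing t with
  | _ N ih =>
    have hfin := finite_criticalTimes (ξ := ξ) hne hp s t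
    rcases Set.eq_empty_or_nonempty (criticalTimes P p ξ ∩ Set.Ioo s t) with hempty | hnonempty
    · refine Relation.ReflTransGen.mono ?_ _ _ h
      rintro z z' ⟨i, n, rfl, hpos'⟩
      refine LineStep.of_no_zero hst.le (fun v hv1 hv2 hv => ?_) hpos'
      have hc : v ∈ criticalTimes P p ξ := ⟨i, n, hnzero (hs.trans_le hv1) hv, hv⟩
      have : v ∈ criticalTimes P p ξ ∩ Set.Ioo s t := ⟨hc, hsc v hc (hs.trans_le hv1), hv2⟩
      rw [hempty] at this
      exact this
    · obtain ⟨t₀, ht₀, hmax⟩ := Set.exists_max_image _ id hfin hnonempty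
      -- The previous critical time, or `s` if there is none. Any time strictly between it and `t₀`
      -- can serve as the next base point.
      obtain ⟨v, hv, hvmax⟩ := Set.exists_max_image
        (insert s (criticalTimes P p ξ ∩ Set.Ioo s t₀)) id
        ((finite_criticalTimes (ξ := ξ) hne hp s t₀).insert s) (Set.insert_nonempty _ _)
      have hsv : s ≤ v := hvmax s (Set.mem_insert _ _)
      have hvt : v < t₀ := by
        rcases hv with rfl | hv
        · exact ht₀.2.1
        · exact hv.2.2
      obtain ⟨w, hvw, hwt⟩ := exists_between hvt
      have hw0 : s < w := hsv.trans_lt hvw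
      have hstep : LineLE P p ξ w x y := by
        refine lineLE_of_critical hξ hp hpos (hs.trans hw0) hwt ht₀.2.2 ht₀.1 ?_ ?_ hx hy h
        · intro c hc h1 h2
          have := hvmax c (Set.mem_insert_of_mem _ ⟨hc, hw0.trans_le h1, h2⟩)
          simp only [id] at this
          linarith
        · intro c hc h1 h2
          have := hmax c ⟨hc, ht₀.2.1.trans h1, h2⟩
          simp only [id] at this
          linarith
      refine ih _ ?_ hw0 hstep rfl
      rw [← hN]
      refine Set.ncard_lt_ncard ⟨?_, fun hsub => ?_⟩ hfin
      · rintro c ⟨hc, h1, h2⟩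
        exact ⟨hc, h1, h2.trans (hwt.trans ht₀.2.2)⟩
      · exact absurd (hsub ht₀).2.2 (not_lt.2 hwt.le)

theorem pair_le_of_weightLE_affRefl [P.IsReduced] {x : X} {i : ι} (hi : b.IsPos i) {n : ℤ}
    (h : WeightLE b x (affRefl P p i n x)) : pair P x i ≤ n * p := by
  have h1 := h.posHeight_le
  rw [affRefl, posHeight_sub, posHeight_smul] at h1
  have h2 := posHeight_root_pos b hi
  by_contra! h3
  nlinarith

/-- A chain uses finitely many walls, and for large $t$ the point $-t\xi$ is on the negative side of
all of them. Upward reflections then lead away from the base point. A step from a weight on its own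
wall is trivial. -/
theorem exists_lineLE_of_up [P.IsReduced] (hpos : ∀ i, b.IsPos i → 0 < ξ (P.coroot i))
    {x y : X} (h : Up b p x y) : ∃ T : ℝ, ∀ t, T ≤ t → LineLE P p ξ t x y := by
  induction h with
  | refl => exact ⟨0, fun _ _ => .refl⟩
  | tail _ h ih =>
    rename_i y z _
    obtain ⟨T, hT⟩ := ih
    obtain ⟨i, hi, n, rfl, hyz⟩ := h
    have hξi := hpos i hi
    rcases (pair_le_of_weightLE_affRefl hi hyz).eq_or_lt with heq | hlt
    · refine ⟨T, fun t ht => ?_⟩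
      have : affRefl P p i n y = y := by rw [affRefl, heq]; simp
      rw [this]
      exact hT t ht
    · refine ⟨max T (|(n : ℝ) * p| / ξ (P.coroot i) + 1), fun t ht => ?_⟩
      refine (hT t (le_of_max_le_left ht)).tail ⟨i, n, rfl, ?_⟩
      refine mul_pos_of_neg_of_neg (by exact_mod_cast (by omega)) ?_
      have h1 : |(n : ℝ) * p| / ξ (P.coroot i) < t := by
        have := le_of_max_le_right ht
        linarith
      rw [div_lt_iff₀ hξi] at h1
      have := neg_abs_le ((n : ℝ) * p)
      linarith

-- A base point this close to $0$ is on the same side as $0$ of every wall with $n\ne 0$, so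
-- reflections away from it are separating steps. Walls with $n=0$ give Weyl group elements.
omit [Finite ι] in
theorem sepLE_of_lineLE {s : ℝ} (hs : ∀ i, |s * ξ (P.coroot i)| < p) {x y : X} (h : LineLE P p ξ s x y) : SepLE P p x y := by
  refine Relation.ReflTransGen.mono ?_ _ _ h
  rintro z z' ⟨i, n, rfl, hpos⟩
  have hsi := abs_lt.1 (hs i)
  have hp' : (0 : ℝ) ≤ p := by positivity
  rcases lt_trichotomy n 0 with hn | rfl | hn
  · left
    refine ⟨negIndex P i, -n, by omega, ?_, (affRefl_negIndex p i n z).symm⟩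
    have hn' : (n : ℝ) ≤ -1 := by exact_mod_cast (by omega)
    have h1 : 0 < -s * ξ (P.coroot i) - n * p := by nlinarith
    have h2 : 0 < ((pair P z i - n * p : ℤ) : ℝ) := (pos_iff_pos_of_mul_pos hpos).2 h1
    have h3 : 0 < pair P z i - n * p := by exact_mod_cast h2
    rw [pair_negIndex]
    linarith
  · right
    exact ⟨refl P i, affRefl_zero p i z⟩
  · left
    refine ⟨i, n, hn, ?_, rfl⟩
    have hn' : (1 : ℝ) ≤ n := by exact_mod_cast hn
    have h1 : -s * ξ (P.coroot i) - n * p < 0 := by nlinarith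
    have h2 : ((pair P z i - n * p : ℤ) : ℝ) < 0 := by
      by_contra! h3
      nlinarith
    have h3 : pair P z i - n * p < 0 := by exact_mod_cast h2
    linarith

theorem pos_of_pos_simple [P.IsReduced] (h : ∀ i ∈ b.support, 0 < ξ (P.coroot i)) {i : ι}
    (hi : b.IsPos i) : 0 < ξ (P.coroot i) := by
  obtain ⟨c, hc, -⟩ := exists_pair_eq_sum b hi
  obtain ⟨j, hj, hcj⟩ := exists_coeff_ne_zero b hc
  rw [hc, map_sum]
  simp only [map_nsmul, nsmul_eq_mul]
  refine Finset.sum_pos' (fun k hk => mul_nonneg (by positivity) (h k hk).le) ⟨j, hj, ?_⟩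
  have := h j hj
  positivity

theorem Up.sepLE [P.IsReduced] [IsSimplyConnected P] (hp : 0 < p) {x y : X} (hx : IsDominant b x)
    (hy : IsDominant b y) (h : Up b p x y) : SepLE P p x y := by
  obtain ⟨ξ, hξ, hsimple⟩ := exists_generic_functional b
  have hpos : ∀ i, b.IsPos i → 0 < ξ (P.coroot i) := fun i hi => pos_of_pos_simple hsimple hi
  have hp' : (0 : ℝ) < p := by exact_mod_cast hp
  obtain ⟨C, hC⟩ : ∃ C : ℝ, ∀ i, |ξ (P.coroot i)| ≤ C := by
    obtain ⟨C, hC⟩ := (Set.finite_range fun i => |ξ (P.coroot i)|).bddAbove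
    exact ⟨C, fun i => hC ⟨i, rfl⟩⟩
  -- Small enough that $-s\xi$ comes before every hyperplane not through the origin.
  set s : ℝ := p / (|C| + 1) with hs
  have hs0 : 0 < s := by positivity
  have hsi (i : ι) : |s * ξ (P.coroot i)| < p := by
    rw [abs_mul, abs_of_pos hs0, hs, div_mul_eq_mul_div, div_lt_iff₀ (by positivity)]
    have := (hC i).trans (le_abs_self C)
    nlinarith
  have hcrit : ∀ v ∈ criticalTimes P p ξ, 0 < v → s < v := by
    rintro v ⟨i, n, hn, hv⟩ hv0
    have h1 : (p : ℝ) ≤ |v * ξ (P.coroot i)| := by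
      rw [hv, abs_neg, abs_mul, abs_of_pos hp']
      have : (1 : ℝ) ≤ |(n : ℝ)| := by exact_mod_cast Int.one_le_abs hn
      nlinarith
    have h2 := (hsi i).trans_le h1
    rw [abs_mul, abs_mul, abs_of_pos hs0, abs_of_pos hv0] at h2
    exact lt_of_mul_lt_mul_right h2 (abs_nonneg _)
  obtain ⟨T, hT⟩ := exists_lineLE_of_up hpos h
  exact sepLE_of_lineLE hsi
    (lineLE_of_lineLE hξ hp hpos hs0 hcrit hx hy (lt_max_of_lt_right (lt_add_one s))
      (hT _ (le_max_left T (s + 1))))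

/-- On dominant weights, the order `↑` is generated by reflections in hyperplanes separating the
target from the origin. -/
theorem upArrow_iff_sepLE [P.IsReduced] [IsSimplyConnected P] (hp : 0 < p) {x y : X}
    (hx : IsDominant b x) (hy : IsDominant b y) :
    UpArrow b p (x - rho b) (y - rho b) ↔ SepLE P p x y := by
  rw [upArrow_iff]
  refine ⟨Up.sepLE hp hx hy, fun h => ?_⟩
  have := h.up_dom (b := b) hp
  rwa [dom_of_isDominant b hx, dom_of_isDominant b hy] at this

end LineOrders

-- The sign character

section Sign

variable {ι X Y : Type*} [AddCommGroup X] [AddCommGroup Y] {P : RootPairing ι ℤ X Y}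

theorem sign_one : sign (1 : P.weylGroup) = 1 := by
  rw [sign, map_one, map_one]

theorem sign_mul (v w : P.weylGroup) : sign (v * w) = sign v * sign w := by
  rw [sign, map_mul, map_mul, sign, sign]

theorem sign_refl [IsSimplyConnected P] (b : P.Base) (i : ι) : sign (refl P i) = -1 := by
  have e : X ≃ₗ[ℤ] Module.Dual ℤ Y := P.toPerfPair
  have hfin : Module.Finite ℤ Y := Module.Finite.of_basis (simpleCorootBasis b)
  have hfree : Module.Free ℤ Y := Module.Free.of_basis (simpleCorootBasis b)
  have : Module.Finite ℤ X := Module.Finite.equiv e.symm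
  have : Module.Free ℤ X := Module.Free.of_equiv e.symm
  have h : P.weylGroupRootRep (refl P i) =
      LinearMap.transvection (-P.coroot' i) (P.root i) := by
    ext x
    change refl P i • x = _
    rw [refl_smul, LinearMap.transvection.apply, LinearMap.neg_apply, neg_smul, ← sub_eq_add_neg]
    rfl
  rw [sign, h, LinearMap.transvection.det]
  simp

theorem sign_eq_one_or [IsSimplyConnected P] (b : P.Base) (w : P.weylGroup) :
    sign w = 1 ∨ sign w = -1 := by
  induction w using weyl_induction with
  | one => exact Or.inl sign_one
  | mul i w ih =>
    rw [sign_mul, sign_refl b]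
    omega

theorem sign_mul_self [IsSimplyConnected P] (b : P.Base) (w : P.weylGroup) :
    sign w * sign w = 1 := by
  rcases sign_eq_one_or b w with h | h <;> rw [h] <;> norm_num

theorem sign_inv [IsSimplyConnected P] (b : P.Base) (w : P.weylGroup) : sign w⁻¹ = sign w := by
  have h : sign w * sign w⁻¹ = 1 := by rw [← sign_mul, mul_inv_cancel, sign_one]
  rcases sign_eq_one_or b w with h1 | h1 <;> rw [h1] at h ⊢ <;> omega

end Sign

-- Invariant and alternating elements of the group ring

section Action

variable {ι X Y : Type*} [AddCommGroup X] [AddCommGroup Y] {P : RootPairing ι ℤ X Y}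

/-- The action of the Weyl group on `ℤ[X]`. -/
def weylAct (w : P.weylGroup) : AddMonoidAlgebra ℤ X →+* AddMonoidAlgebra ℤ X :=
  mapDomainRingHom ℤ (DistribSMul.toAddMonoidHom X w)

theorem coeff_weylAct (w : P.weylGroup) (f : AddMonoidAlgebra ℤ X) (x : X) :
    (weylAct w f).coeff (w • x) = f.coeff x := by
  change (mapDomain (w • ·) f).coeff (w • x) = _
  rw [coeff_mapDomain]
  exact Finsupp.mapDomain_apply (MulAction.injective w) _ _

theorem weylAct_single (w : P.weylGroup) (x : X) (n : ℤ) :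
    weylAct w (single x n) = single (w • x) n :=
  mapDomain_single

theorem isWeylInvariant_iff {f : AddMonoidAlgebra ℤ X} :
    IsWeylInvariant P f ↔ ∀ w : P.weylGroup, weylAct w f = f := by
  constructor
  · intro h w
    ext x
    have h1 := h w (w⁻¹ • x)
    rw [smul_inv_smul] at h1
    rw [h1, ← coeff_weylAct w f, smul_inv_smul]
  · intro h w x
    rw [← coeff_weylAct w f x, h]

/-- Anti-invariant elements of `ℤ[X]`. -/
def IsAlternating (P : RootPairing ι ℤ X Y) (f : AddMonoidAlgebra ℤ X) : Prop :=
  ∀ w : P.weylGroup, weylAct w f = sign w • f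

variable {f g : AddMonoidAlgebra ℤ X}

theorem IsAlternating.coeff_smul [IsSimplyConnected P] (b : P.Base) (hf : IsAlternating P f)
    (w : P.weylGroup) (x : X) : f.coeff (w • x) = sign w * f.coeff x := by
  have h := coeff_weylAct w f x
  rw [hf w] at h
  have h2 : sign w * f.coeff (w • x) = f.coeff x := h
  rw [← h2, ← mul_assoc, sign_mul_self b, one_mul]

theorem IsAlternating.zsmul (n : ℤ) (hf : IsAlternating P f) : IsAlternating P (n • f) := by
  intro w
  rw [map_zsmul, hf w, smul_comm]

theorem IsAlternating.sum {κ : Type*} (s : Finset κ) {F : κ → AddMonoidAlgebra ℤ X}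
    (h : ∀ k ∈ s, IsAlternating P (F k)) : IsAlternating P (∑ k ∈ s, F k) := by
  intro w
  rw [map_sum, Finset.smul_sum]
  exact Finset.sum_congr rfl fun k hk => h k hk w

theorem IsWeylInvariant.mul_isAlternating (hf : IsWeylInvariant P f) (hg : IsAlternating P g) :
    IsAlternating P (f * g) := by
  intro w
  rw [map_mul, isWeylInvariant_iff.1 hf w, hg w, mul_smul_comm]

theorem IsWeylInvariant.mul (hf : IsWeylInvariant P f) (hg : IsWeylInvariant P g) :
    IsWeylInvariant P (f * g) := by
  rw [isWeylInvariant_iff] at *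
  intro w
  rw [map_mul, hf w, hg w]

theorem IsWeylInvariant.sub_zsmul (hf : IsWeylInvariant P f) (hg : IsWeylInvariant P g) (n : ℤ) :
    IsWeylInvariant P (f - n • g) := by
  rw [isWeylInvariant_iff] at *
  intro w
  rw [map_sub, map_zsmul, hf w, hg w]

end Action

-- Alternants as a basis of the alternating elements

section Alternants

variable {ι X Y : Type*} [Finite ι] [AddCommGroup X] [AddCommGroup Y] {P : RootPairing ι ℤ X Y}
  [IsSimplyConnected P] (b : P.Base)

instance fintypeWeylGroup : Fintype P.weylGroup := Fintype.ofFinite _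

theorem alternant_eq_sum (x : X) : alternant P x = ∑ w : P.weylGroup, single (w • x) (sign w) :=
  finsum_eq_sum_of_fintype _

theorem coeff_mul_alternant (f : AddMonoidAlgebra ℤ X) (x z : X) :
    (f * alternant P x).coeff z = ∑ w : P.weylGroup, sign w * f.coeff (z - w • x) := by
  rw [alternant_eq_sum, Finset.mul_sum, coeff_sum, Finset.sum_apply']
  refine Finset.sum_congr rfl fun w _ => ?_
  rw [coeff_mul_single_apply, mul_comm, sub_eq_add_neg]

include b in
theorem coeff_mul_alternant_of_invariant {f : AddMonoidAlgebra ℤ X} (hf : IsWeylInvariant P f)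
    (x z : X) :
    (f * alternant P x).coeff z = ∑ w : P.weylGroup, sign w * f.coeff (w • z - x) := by
  rw [coeff_mul_alternant]
  refine Fintype.sum_equiv (Equiv.inv _) _ _ fun w => ?_
  rw [Equiv.inv_apply, sign_inv b, ← hf w (w⁻¹ • z - x), smul_sub, smul_inv_smul]

include b in
theorem isAlternating_alternant (x : X) : IsAlternating P (alternant P x) := by
  intro v
  rw [alternant_eq_sum, map_sum, Finset.smul_sum]
  refine Fintype.sum_equiv (Equiv.mulLeft v) _ _ fun w => ?_
  rw [Equiv.coe_mulLeft, weylAct_single, smul_single, mul_smul, sign_mul, smul_eq_mul, ← mul_assoc,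
    sign_mul_self b, one_mul]

variable [P.IsReduced]

theorem coeff_alternant_self {z : X} (hz : IsStrictlyDominant b z) :
    (alternant P z).coeff z = 1 := by
  classical
  rw [alternant_eq_sum, coeff_sum, Finset.sum_apply', Finset.sum_eq_single_of_mem 1 (Finset.mem_univ _)]
  · simp [sign_one]
  · intro w _ hw
    rw [coeff_single, Finsupp.single_apply, if_neg]
    intro h
    exact hw (hz.eq_one (by rw [h]; exact hz.isDominant))

theorem coeff_alternant_of_ne {z y : X} (hz : IsStrictlyDominant b z) (hy : IsDominant b y)
    (h : z ≠ y) : (alternant P z).coeff y = 0 := by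
  classical
  rw [alternant_eq_sum, coeff_sum, Finset.sum_apply']
  refine Finset.sum_eq_zero fun w _ => ?_
  rw [coeff_single, Finsupp.single_apply, if_neg]
  rintro rfl
  exact h (hz.isDominant.smul_eq_self w hy).symm

/-- Alternating elements vanish on the walls, and every orbit off the walls contains a strictly
dominant weight. -/
theorem IsAlternating.ext {f g : AddMonoidAlgebra ℤ X} (hf : IsAlternating P f)
    (hg : IsAlternating P g) (h : ∀ z, IsStrictlyDominant b z → f.coeff z = g.coeff z) : f = g := by
  have hzero : ∀ {f : AddMonoidAlgebra ℤ X}, IsAlternating P f → ∀ {i : ι} {z : X},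
      pair P z i = 0 → f.coeff z = 0 := by
    intro f hf i z hz
    have h1 := hf.coeff_smul b (refl P i) z
    rw [sign_refl b, refl_smul, hz, zero_smul, sub_zero] at h1
    omega
  ext x
  obtain ⟨w, hw⟩ := exists_smul_isDominant b x
  have key : f.coeff (w • x) = g.coeff (w • x) := by
    by_cases hs : IsStrictlyDominant b (w • x)
    · exact h _ hs
    · simp only [IsStrictlyDominant, not_forall] at hs
      obtain ⟨i, hi, hle⟩ := hs
      have h0 : pair P (w • x) i = 0 := le_antisymm (not_lt.1 hle) (hw i hi)
      rw [hzero hf h0, hzero hg h0]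
  rw [hf.coeff_smul b, hg.coeff_smul b] at key
  rcases sign_eq_one_or b w with h1 | h1 <;> rw [h1] at key <;> omega

omit [Finite ι] [P.IsReduced] in
theorem isStrictlyDominant_add_rho {x : X} (hx : IsDominant b x) :
    IsStrictlyDominant b (x + rho b) := by
  intro i hi
  rw [pair_add, pair_rho b hi]
  have := hx i hi
  omega

omit [Finite ι] [P.IsReduced] in
theorem isDominant_sub_rho {x : X} (hx : IsStrictlyDominant b x) : IsDominant b (x - rho b) := by
  intro i hi
  rw [pair_sub, pair_rho b hi]
  have := hx i hi
  omega

/-- The coefficients of an alternating element with respect to the alternants of the strictly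
dominant weights, indexed by dominant weights. -/
def altCoeff (f : AddMonoidAlgebra ℤ X) : X →₀ ℤ :=
  open Classical in
  (f.coeff.comapDomain (· + rho b) (add_left_injective _).injOn).filter (IsDominant b)

omit [Finite ι] [P.IsReduced] in
theorem altCoeff_apply (f : AddMonoidAlgebra ℤ X) {ν : X} (hν : IsDominant b ν) :
    altCoeff b f ν = f.coeff (ν + rho b) := by
  classical
  rw [altCoeff, Finsupp.filter_apply_pos _ _ hν, Finsupp.comapDomain_apply]

omit [Finite ι] [P.IsReduced] in
theorem isDominant_of_mem_support_altCoeff {f : AddMonoidAlgebra ℤ X} {ν : X}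
    (hν : ν ∈ (altCoeff b f).support) : IsDominant b ν := by
  classical
  by_contra h
  rw [Finsupp.mem_support_iff, altCoeff, Finsupp.filter_apply_neg _ _ h] at hν
  exact hν rfl

theorem coeff_sum_alternant {a : X →₀ ℤ} (ha : ∀ ν ∈ a.support, IsDominant b ν) {ν : X}
    (hν : IsDominant b ν) :
    (a.sum fun ν c => c • alternant P (ν + rho b)).coeff (ν + rho b) = a ν := by
  classical
  rw [Finsupp.sum, coeff_sum, Finset.sum_apply']
  by_cases h : ν ∈ a.support
  · rw [Finset.sum_eq_single_of_mem ν h]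
    · rw [coeff_smul, Finsupp.smul_apply, coeff_alternant_self b (isStrictlyDominant_add_rho b hν)]
      simp
    · intro κ hκ hne
      rw [coeff_smul, Finsupp.smul_apply,
        coeff_alternant_of_ne b (isStrictlyDominant_add_rho b (ha κ hκ))
          (isStrictlyDominant_add_rho b hν).isDominant (fun h => hne (add_right_cancel h)), smul_zero]
  · rw [Finsupp.notMem_support_iff.1 h]
    refine Finset.sum_eq_zero fun κ hκ => ?_
    rw [coeff_smul, Finsupp.smul_apply,
      coeff_alternant_of_ne b (isStrictlyDominant_add_rho b (ha κ hκ))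
        (isStrictlyDominant_add_rho b hν).isDominant, smul_zero]
    intro h'
    rw [add_right_cancel h'] at hκ
    exact h hκ

omit [P.IsReduced] in
theorem isAlternating_sum_alternant (a : X →₀ ℤ) :
    IsAlternating P (a.sum fun ν c => c • alternant P (ν + rho b)) :=
  IsAlternating.sum _ fun _ _ => (isAlternating_alternant b _).zsmul _

theorem IsAlternating.eq_sum_altCoeff {f : AddMonoidAlgebra ℤ X} (hf : IsAlternating P f) :
    f = (altCoeff b f).sum fun ν c => c • alternant P (ν + rho b) := by
  refine hf.ext b (isAlternating_sum_alternant b _) fun z hz => ?_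
  have hz' := isDominant_sub_rho b hz
  have h := coeff_sum_alternant b (fun ν hν => isDominant_of_mem_support_altCoeff b hν) hz'
    (a := altCoeff b f)
  rw [altCoeff_apply b f hz', sub_add_cancel] at h
  exact h.symm

end Alternants

-- Weyl characters and expansions in them

section WeylCharacters

variable {ι X Y : Type*} [Finite ι] [AddCommGroup X] [AddCommGroup Y] {P : RootPairing ι ℤ X Y}
  [IsSimplyConnected P] (b : P.Base)

theorem coeff_orbitSum (μ ν : X) [Decidable (∃ w : P.weylGroup, w • μ = ν)] :
    (orbitSum P μ).coeff ν = if ∃ w : P.weylGroup, w • μ = ν then 1 else 0 := by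
  classical
  have hfin : (MulAction.orbit P.weylGroup μ).Finite := Set.finite_range _
  rw [orbitSum, finsum_mem_eq_finite_toFinset_sum _ hfin, coeff_sum, Finset.sum_apply']
  simp only [coeff_single, Finsupp.single_apply]
  rw [Finset.sum_ite_eq']
  simp only [Set.Finite.mem_toFinset]
  exact if_congr Iff.rfl rfl rfl

theorem isWeylInvariant_orbitSum (μ : X) : IsWeylInvariant P (orbitSum P μ) := by
  classical
  intro w x
  rw [coeff_orbitSum, coeff_orbitSum]
  refine if_congr ?_ rfl rfl
  constructor
  · rintro ⟨v, hv⟩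
    exact ⟨w⁻¹ * v, by rw [mul_smul, hv, inv_smul_smul]⟩
  · rintro ⟨v, rfl⟩
    exact ⟨w * v, mul_smul _ _ _⟩

include b in
omit [Finite ι] in
theorem noZeroDivisors_groupRing : NoZeroDivisors (AddMonoidAlgebra ℤ X) := by
  let f : X →+ (b.support → ℤ) :=
    { toFun := fun x i => pair P x i
      map_zero' := by ext i; exact pair_zero _
      map_add' := fun x y => by ext i; exact pair_add x y _ }
  have hf : Function.Injective f := fun x y hxy =>
    eq_of_pair_eq b fun i hi => congrFun hxy ⟨i, hi⟩
  have : UniqueSums X := UniqueSums.of_injective_addHom f.toAddHom hf inferInstance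
  infer_instance

variable [P.IsReduced]

theorem alternant_rho_ne_zero : alternant P (rho b) ≠ 0 := by
  intro h
  have := coeff_alternant_self b (isStrictlyDominant_rho b)
  rw [h] at this
  simp at this

theorem eq_of_mul_alternant_rho_eq {f g : AddMonoidAlgebra ℤ X}
    (h : f * alternant P (rho b) = g * alternant P (rho b)) : f = g := by
  have := noZeroDivisors_groupRing b
  exact mul_right_cancel₀ (alternant_rho_ne_zero b) h

theorem weightLE_of_isDominant_smul {z : X} (hz : IsDominant b z) (w : P.weylGroup) :
    WeightLE b (w • z) z := by
  have := weightLE_dom b (w • z)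
  rwa [dom_smul, dom_of_isDominant b hz] at this

/-- Divisibility by the Weyl denominator, by induction on height. The product of $s(\nu)$ with the
denominator is the alternant at $\nu+\rho$ plus alternants at $\kappa+\rho$ with $\kappa<\nu$, and
these lower ones are already multiples of the denominator. -/
theorem exists_weylChar {ν : X} (hν : IsDominant b ν) :
    ∃ c, IsWeylInvariant P c ∧ c * alternant P (rho b) = alternant P (ν + rho b) := by
  classical
  induction hN : (posHeight b ν).toNat using Nat.strong_induction_on generalizing ν with
  | _ N ih =>
    set f := orbitSum P ν * alternant P (rho b) with hf
    have hfalt : IsAlternating P f :=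
      (isWeylInvariant_orbitSum ν).mul_isAlternating (isAlternating_alternant b _)
    have hterm : ∀ κ, IsDominant b κ → ∀ w : P.weylGroup,
        (orbitSum P ν).coeff (κ + rho b - w • rho b) ≠ 0 →
          WeightLE b κ ν ∧ (κ = ν → w = 1) := by
      intro κ hκ w hne
      rw [coeff_orbitSum] at hne
      obtain ⟨v, hv⟩ : ∃ v : P.weylGroup, v • ν = κ + rho b - w • rho b := by
        by_contra h
        exact hne (if_neg h)
      have h1 : WeightLE b (κ + rho b - w • rho b) ν := hv ▸ weightLE_of_isDominant_smul b hν v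
      have h2 : WeightLE b (w • rho b) (rho b) :=
        weightLE_of_isDominant_smul b (isStrictlyDominant_rho b).isDominant w
      have h3 : WeightLE b κ (κ + rho b - w • rho b) := by
        rw [WeightLE] at h2 ⊢
        convert h2 using 1
        abel
      refine ⟨h3.trans h1, ?_⟩
      rintro rfl
      have h4 := h3.antisymm h1
      have h5 : w • rho b = rho b := by
        have : κ + rho b - w • rho b = κ := h4.symm
        have h6 : κ + rho b = κ + w • rho b := by rw [← sub_eq_iff_eq_add]; exact this
        exact (add_left_cancel h6).symm
      exact (isStrictlyDominant_rho b).eq_one (by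
        rw [h5]; exact (isStrictlyDominant_rho b).isDominant)
    have hlead : altCoeff b f ν = 1 := by
      rw [altCoeff_apply b f hν, hf, coeff_mul_alternant,
        Finset.sum_eq_single_of_mem 1 (Finset.mem_univ _)]
      · rw [sign_one, one_smul, add_sub_cancel_right, coeff_orbitSum, if_pos ⟨1, one_smul _ _⟩,
          one_mul]
      · intro w _ hw
        by_contra hne
        exact hw ((hterm ν hν w (right_ne_zero_of_mul hne)).2 rfl)
    have hlower : ∀ κ ∈ (altCoeff b f).support.erase ν, IsDominant b κ ∧
        (posHeight b κ).toNat < N := by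
      intro κ hκ
      rw [Finset.mem_erase] at hκ
      have hκd := isDominant_of_mem_support_altCoeff b hκ.2
      refine ⟨hκd, ?_⟩
      have hne := Finsupp.mem_support_iff.1 hκ.2
      rw [altCoeff_apply b f hκd, hf, coeff_mul_alternant] at hne
      obtain ⟨w, -, hw⟩ := Finset.exists_ne_zero_of_sum_ne_zero hne
      have hle := (hterm κ hκd w (right_ne_zero_of_mul hw)).1
      rcases hle.eq_or_lt with h | h
      · exact absurd h hκ.1
      · have := posHeight_nonneg b hκd
        omega
    have hex : ∀ κ, ∃ c, κ ∈ (altCoeff b f).support.erase ν →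
        IsWeylInvariant P c ∧ c * alternant P (rho b) = alternant P (κ + rho b) := by
      intro κ
      by_cases hκ : κ ∈ (altCoeff b f).support.erase ν
      · obtain ⟨c, hc⟩ := ih _ (hlower κ hκ).2 (hlower κ hκ).1 rfl
        exact ⟨c, fun _ => hc⟩
      · exact ⟨0, fun h => absurd h hκ⟩
    choose c hc using hex
    refine ⟨orbitSum P ν - ∑ κ ∈ (altCoeff b f).support.erase ν, altCoeff b f κ • c κ, ?_, ?_⟩
    · rw [isWeylInvariant_iff]
      intro w
      rw [map_sub, map_sum, isWeylInvariant_iff.1 (isWeylInvariant_orbitSum ν) w]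
      congr 1
      refine Finset.sum_congr rfl fun κ hκ => ?_
      rw [map_zsmul, isWeylInvariant_iff.1 (hc κ hκ).1 w]
    · have hmem : ν ∈ (altCoeff b f).support := by
        rw [Finsupp.mem_support_iff, hlead]; norm_num
      have h1 := hfalt.eq_sum_altCoeff b
      rw [Finsupp.sum, ← Finset.add_sum_erase _ _ hmem, hlead, one_smul] at h1
      rw [sub_mul, ← hf, Finset.sum_mul, sub_eq_iff_eq_add]
      refine h1.trans ?_
      congr 1
      refine Finset.sum_congr rfl fun κ hκ => ?_
      rw [smul_mul_assoc, (hc κ hκ).2]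

theorem weylChar_mul_alternant {ν : X} (hν : IsDominant b ν) :
    weylChar b ν * alternant P (rho b) = alternant P (ν + rho b) := by
  obtain ⟨c, -, hc⟩ := exists_weylChar b hν
  have h : ∃ c, c * alternant P (rho b) = alternant P (ν + rho b) := ⟨c, hc⟩
  rw [weylChar, dif_pos h]
  exact h.choose_spec

theorem isWeylInvariant_weylChar {ν : X} (hν : IsDominant b ν) :
    IsWeylInvariant P (weylChar b ν) := by
  obtain ⟨c, h1, h2⟩ := exists_weylChar b hν
  rwa [eq_of_mul_alternant_rho_eq b ((weylChar_mul_alternant b hν).trans h2.symm)]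

/-- Multiplication by the Weyl denominator is injective and takes Weyl characters to alternants, so
the expansion exists, is unique, and can be read off at strictly dominant weights. -/
theorem isWeylExpansion_iff {η : AddMonoidAlgebra ℤ X} (hη : IsWeylInvariant P η) {a : X →₀ ℤ} :
    IsWeylExpansion b η a ↔ a = altCoeff b (η * alternant P (rho b)) := by
  have key : ∀ a : X →₀ ℤ, (∀ ν ∈ a.support, IsDominant b ν) →
      (a.sum fun ν c => c • weylChar b ν) * alternant P (rho b) =
        a.sum fun ν c => c • alternant P (ν + rho b) := by
    intro a ha
    rw [Finsupp.sum, Finset.sum_mul]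
    refine Finset.sum_congr rfl fun ν hν => ?_
    rw [smul_mul_assoc, weylChar_mul_alternant b (ha ν hν)]
  constructor
  · rintro ⟨ha, h⟩
    ext ν
    by_cases hν : IsDominant b ν
    · rw [altCoeff_apply b _ hν, h, key a ha, coeff_sum_alternant b ha hν]
    · have h1 : a ν = 0 := by
        by_contra h
        exact hν (ha ν (Finsupp.mem_support_iff.2 h))
      rw [h1]
      by_contra h
      exact hν (isDominant_of_mem_support_altCoeff b (Finsupp.mem_support_iff.2 (Ne.symm h)))
  · rintro rfl
    refine ⟨fun ν hν => isDominant_of_mem_support_altCoeff b hν, ?_⟩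
    apply eq_of_mul_alternant_rho_eq b
    rw [key _ fun ν hν => isDominant_of_mem_support_altCoeff b hν]
    exact (hη.mul_isAlternating (isAlternating_alternant b _)).eq_sum_altCoeff b

/-- The coefficient of the Weyl character of highest weight `ν` in `η χ(κ)`. -/
theorem altCoeff_weylChar_mul {η : AddMonoidAlgebra ℤ X} (hη : IsWeylInvariant P η) {κ ν : X}
    (hκ : IsDominant b κ) (hν : IsDominant b ν) :
    altCoeff b (weylChar b κ * η * alternant P (rho b)) ν =
      ∑ w : P.weylGroup, sign w * η.coeff (w • (ν + rho b) - (κ + rho b)) := by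
  rw [mul_right_comm, weylChar_mul_alternant b hκ, mul_comm, altCoeff_apply b _ hν,
    coeff_mul_alternant_of_invariant b hη]

end WeylCharacters

-- Inversions and stabilisers

section Inversions

variable {ι X Y : Type*} [Finite ι] [AddCommGroup X] [AddCommGroup Y] {P : RootPairing ι ℤ X Y}
  [P.IsReduced] (b : P.Base)

/-- Peeling off a descent $i$ writes $u$ as $s_{u\alpha_i}$ times $us_i$. The first factor fixes $d$
by orthogonality. The second does so by induction, since its negative images of positive roots are
among those of $u$. -/
theorem smul_eq_self_of_inversions (d : X) (u : P.weylGroup)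
    (h : ∀ i, b.IsPos i → ¬ b.IsPos (u • i) → pair P d (u • i) = 0) : u • d = d := by
  induction u using descent_induction b with
  | one => rw [one_smul]
  | step w i hi hneg ih =>
    have h1 : (w * refl P i) • d = d := by
      refine ih fun j hj hj' => ?_
      rw [mul_smul] at hj' ⊢
      have hji : j ≠ i := by
        rintro rfl
        apply hj'
        change b.IsPos (w • negIndex P j)
        rwa [smul_negIndex, isPos_negIndex_iff]
      exact h _ (isPos_refl_smul b hi hj hji) hj'
    have h2 : refl P (w • i) • d = d := by
      rw [refl_smul, h i (isPos_simple b hi) hneg]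
      simp
    rw [refl_weyl_smul] at h2
    have h3 : (w * refl P i) • w⁻¹ • d = (w * refl P i) • d := by rw [h1, ← mul_smul]; exact h2
    exact (inv_smul_eq_iff.1 (MulAction.injective _ h3)).symm

/-- If a simple root $\alpha_i$ goes to $-\alpha_k$, then $us_i\ne 1$ has a simple inversion $j$ of
its own, and $s_i\alpha_j$ is a second inversion of $u$. -/
theorem exists_inversion_ne {u : P.weylGroup} {k : ι} (h1 : u ≠ 1)
    (h2 : u ≠ refl P k) : ∃ i, b.IsPos i ∧ ¬ b.IsPos (u • i) ∧ u • i ≠ negIndex P k := by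
  obtain ⟨i, hi, hneg⟩ := exists_simple_inversion b h1
  by_cases hik : u • i = negIndex P k
  · have hne : u * refl P i ≠ 1 := by
      intro h
      have hu : u = refl P i := by rw [← refl_inv]; exact eq_inv_of_mul_eq_one_left h
      rw [hu] at hik h2
      have h3 : negIndex P i = negIndex P k := hik
      rw [← negIndex_negIndex (P := P) i, h3, negIndex_negIndex] at h2
      exact h2 rfl
    obtain ⟨j, hj, hneg'⟩ := exists_simple_inversion b hne
    have hji : j ≠ i := by
      rintro rfl
      apply hneg'
      rw [mul_smul]
      change b.IsPos (u • negIndex P j)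
      rwa [smul_negIndex, isPos_negIndex_iff]
    refine ⟨refl P i • j, isPos_refl_smul b hi (isPos_simple b hj) hji, by rwa [← mul_smul], ?_⟩
    intro h
    rw [← hik] at h
    have h3 : refl P i • j = i := MulAction.injective u h
    have h4 := isPos_simple b hj
    rw [eq_inv_smul_iff.2 h3, refl_inv] at h4
    exact (isPos_negIndex_iff b i).1 h4 (isPos_simple b hi)
  · exact ⟨i, isPos_simple b hi, hneg, hik⟩

theorem exists_smul_simple (i : ι) : ∃ w : P.weylGroup, ∃ j ∈ b.support, w • i = j := by
  refine RootPairing.Base.induction_reflect (b := b) i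
    (p := fun i => ∃ w : P.weylGroup, ∃ j ∈ b.support, w • i = j) ?_ ?_ ?_
  · rintro i ⟨w, j, hj, h⟩
    refine ⟨w * refl P i, j, hj, ?_⟩
    change (w * refl P i) • refl P i • i = j
    rw [mul_smul, refl_smul_smul_index, h]
  · exact fun i hi => ⟨1, i, hi, one_smul _ _⟩
  · rintro i k ⟨w, j, hj, h⟩ -
    refine ⟨w * refl P k, j, hj, ?_⟩
    change (w * refl P k) • refl P k • i = j
    rw [mul_smul, refl_smul_smul_index, h]

/-- If $\alpha_i^\vee=c\,\alpha_k^\vee$, then $s_k\alpha_i^\vee$ pairs with $\rho$ to $c-2c\le 0$.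
But $s_k$ keeps every positive root other than $\alpha_k$ positive. -/
theorem exists_coeff_ne_zero_of_ne [IsSimplyConnected P] {i k : ι} (hi : b.IsPos i)
    (hk : k ∈ b.support) (hik : i ≠ k) {c : ι → ℕ}
    (hc : P.coroot i = ∑ j ∈ b.support, c j • P.coroot j) : ∃ j ∈ b.support, j ≠ k ∧ c j ≠ 0 := by
  by_contra! h
  have hc' : P.coroot i = c k • P.coroot k := by
    rw [hc]
    exact Finset.sum_eq_single_of_mem k hk fun j hj hjk => by rw [h j hj hjk, zero_smul]
  have hρ : ∀ x : X, pair P x i = c k * pair P x k := by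
    intro x
    rw [pair, hc']
    simp [pair]
  have h1 := pair_pos b (isStrictlyDominant_rho b) (isPos_refl_smul b hk hi hik)
  have h2 : pair P (P.root k) i = c k * 2 := by rw [hρ, pair_root_self]
  rw [pair_refl_smul_index, hρ, pair_rho b hk, ← pair_root, h2] at h1
  omega

end Inversions

-- Coefficients of products with Steinberg type characters

section BrauerCoefficients

variable {ι X Y : Type*} [Finite ι] [AddCommGroup X] [AddCommGroup Y] {P : RootPairing ι ℤ X Y}
  [IsSimplyConnected P] (b : P.Base) (p : ℕ)

/-- The coefficient of the Weyl character of highest weight `pδ + y - ρ` in `η χ(pδ - ρ)`, by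
Brauer's formula. -/
def brauerCoeff (P : RootPairing ι ℤ X Y) [IsSimplyConnected P] (p : ℕ) (η : AddMonoidAlgebra ℤ X)
    (δ y : X) : ℤ :=
  ∑ u : P.weylGroup, sign u * η.coeff (u • ((p : ℤ) • δ + y) - (p : ℤ) • δ)

variable [P.IsReduced] {b p}

theorem SepStep.posHeight_lt (hp : 0 < p) {x y : X} (h : SepStep P p x y) :
    posHeight b (dom b x) < posHeight b (dom b y) := by
  obtain ⟨h1, h2⟩ := h.up_dom (b := b) hp
  exact (h1.weightLE.eq_or_lt).resolve_left h2

/-- Climb the orbit of $p\delta+y$ to its dominant member. Seen from $p\delta$, each simple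
reflection is a reflection in the hyperplane where $-\alpha_i^\vee$ equals
$\langle\delta,\alpha_i^\vee\rangle p$. The level is positive as $\delta$ is strictly dominant, so
descending in the orbit is a separating step. -/
theorem smul_sub_eq_or_sepLE (hp : 0 < p) {δ y : X} (hδ : IsStrictlyDominant b δ)
    (hy : IsStrictlyDominant b ((p : ℤ) • δ + y)) (z : X) :
    (∃ u : P.weylGroup, z = u • ((p : ℤ) • δ + y)) → z = (p : ℤ) • δ + y ∨
      (SepLE P p y (z - (p : ℤ) • δ) ∧
        posHeight b (dom b y) < posHeight b (dom b (z - (p : ℤ) • δ))) := by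
  induction z using climb_induction b with
  | dom z hz =>
    rintro ⟨u, rfl⟩
    exact Or.inl (hy.isDominant.smul_eq_self u hz)
  | step z i hi hneg ih =>
    rintro ⟨u, hu⟩
    right
    have hstep : SepStep P p (refl P i • z - (p : ℤ) • δ) (z - (p : ℤ) • δ) := by
      refine ⟨negIndex P i, pair P δ i, hδ i hi, ?_, ?_⟩
      · rw [pair_negIndex, pair_sub, pair_smul, pair_weyl_smul_left, refl_inv]
        change -(pair P z (negIndex P i) - _) < _
        rw [pair_negIndex]
        linarith
      · rw [affRefl, pair_negIndex, pair_sub, pair_smul, pair_weyl_smul_left, refl_inv]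
        change _ = _ - (-(pair P z (negIndex P i) - _) - _) • _
        rw [pair_negIndex, root_negIndex, refl_smul]
        module
    rcases ih ⟨refl P i * u, by rw [mul_smul, ← hu]⟩ with h | ⟨h1, h2⟩
    · rw [h, add_sub_cancel_left] at hstep
      exact ⟨.of_step hstep, hstep.posHeight_lt hp⟩
    · exact ⟨Relation.ReflTransGen.trans h1 (SepLE.of_step hstep), h2.trans (hstep.posHeight_lt hp)⟩

theorem sepLE_of_ne_one (hp : 0 < p) {δ y : X} (hδ : IsStrictlyDominant b δ)
    (hy : IsStrictlyDominant b ((p : ℤ) • δ + y)) {u : P.weylGroup} (hu : u ≠ 1) :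
    SepLE P p y (u • ((p : ℤ) • δ + y) - (p : ℤ) • δ) ∧
      posHeight b (dom b y) < posHeight b (dom b (u • ((p : ℤ) • δ + y) - (p : ℤ) • δ)) := by
  refine (smul_sub_eq_or_sepLE hp hδ hy _ ⟨u, rfl⟩).resolve_left fun h => hu ?_
  exact hy.eq_one (by rw [h]; exact hy.isDominant)

/-- The coefficients `brauerCoeff` are unitriangular. -/
theorem brauerCoeff_sub_eq (hp : 0 < p) {η η' : AddMonoidAlgebra ℤ X} {δ y : X}
    (hδ : IsStrictlyDominant b δ) (hy : IsStrictlyDominant b ((p : ℤ) • δ + y))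
    (h : ∀ x, SepLE P p y x → posHeight b (dom b y) < posHeight b (dom b x) →
      η.coeff x = η'.coeff x) :
    brauerCoeff P p η δ y - η.coeff y = brauerCoeff P p η' δ y - η'.coeff y := by
  classical
  have key (η : AddMonoidAlgebra ℤ X) : brauerCoeff P p η δ y - η.coeff y =
      ∑ u ∈ Finset.univ.erase (1 : P.weylGroup),
        sign u * η.coeff (u • ((p : ℤ) • δ + y) - (p : ℤ) • δ) := by
    rw [brauerCoeff, ← Finset.add_sum_erase _ _ (Finset.mem_univ (1 : P.weylGroup)), sign_one,
      one_smul, add_sub_cancel_left]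
    ring
  rw [key, key]
  refine Finset.sum_congr rfl fun u hu => ?_
  obtain ⟨h1, h2⟩ := sepLE_of_ne_one hp hδ hy (Finset.ne_of_mem_erase hu)
  rw [h _ h1 h2]

theorem brauerCoeff_eq_zero (hp : 0 < p) {η : AddMonoidAlgebra ℤ X} {δ y : X}
    (hδ : IsStrictlyDominant b δ) (hy : IsStrictlyDominant b ((p : ℤ) • δ + y))
    (h : ∀ x, SepLE P p y x → η.coeff x = 0) : brauerCoeff P p η δ y = 0 := by
  have := brauerCoeff_sub_eq (η' := 0) hp hδ hy (fun x hx _ => by rw [h x hx]; rfl)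
  rw [h y .refl] at this
  simpa [brauerCoeff] using this

variable [IsIrreducibleDatum P] {lam : X}

theorem pair_le_of_sepLE (hp : 0 < p) (hlam : IsDominant b lam) {x : X} (hx : SepLE P p x lam)
    (i : ι) : pair P x i ≤ pair P lam (highestCoroot b) := by
  have := (hx.up_dom (b := b) hp).weightLE
  rw [dom_of_isDominant b hlam] at this
  exact pair_le_of_dom_le b this i

variable {m : ℕ}

/-- A term of Brauer's formula lying below $\lambda$ bounds $\delta$ on the inversions of $u$: where
$\delta$ is at least $m$, the argument would be too far out to be below $\lambda$. -/
theorem pair_negIndex_lt (hp : 0 < p) (hlam : IsDominant b lam)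
    (hm : pair P lam (highestCoroot b) < p * m) {δ y : X}
    (hy : IsStrictlyDominant b ((p : ℤ) • δ + y)) {u : P.weylGroup}
    (hu : SepLE P p (u • ((p : ℤ) • δ + y) - (p : ℤ) • δ) lam) {i : ι} (hi : b.IsPos i) :
    pair P δ (negIndex P (u • i)) < m := by
  have h1 := (pair_le_of_sepLE hp hlam hu (u • i)).trans_lt hm
  rw [pair_sub, pair_weyl_smul, pair_smul] at h1
  have h2 := pair_pos b hy hi
  have h3 : (p : ℤ) * pair P δ (negIndex P (u • i)) < p * m := by
    rw [pair_negIndex]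
    linarith
  exact lt_of_mul_lt_mul_left h3 (by positivity)

theorem isStrictlyDominant_of_sepLE (hp : 0 < p) (hlam : IsDominant b lam)
    (hm : pair P lam (highestCoroot b) < p * m) {y : X} (hy : SepLE P p y lam) {i : ι} :
    0 < (p : ℤ) * m + pair P y i := by
  have := (pair_le_of_sepLE hp hlam hy (negIndex P i)).trans_lt hm
  rw [pair_negIndex] at this
  linarith

/-- On the positive coroot attached to an inversion of $u$, $\delta$ is less than $m$. So only
simple coroots on which $\delta$ is less than $m$ occur in it, and $d$ vanishes on those. -/
theorem smul_eq_self_of_sepLE (hp : 0 < p) (hlam : IsDominant b lam)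
    (hm : pair P lam (highestCoroot b) < p * m) {δ d y : X} (hδ : IsDominant b δ)
    (hd : ∀ i ∈ b.support, pair P δ i < m → pair P d i = 0)
    (hy : IsStrictlyDominant b ((p : ℤ) • δ + y)) {u : P.weylGroup}
    (hu : SepLE P p (u • ((p : ℤ) • δ + y) - (p : ℤ) • δ) lam) : u • d = d := by
  refine smul_eq_self_of_inversions b d u fun i hi hneg => ?_
  have hlt := pair_negIndex_lt hp hlam hm hy hu hi
  rw [← isPos_negIndex_iff] at hneg
  obtain ⟨c, hc, hsum⟩ := exists_pair_eq_sum b hneg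
  have h0 : pair P d (negIndex P (u • i)) = 0 := by
    rw [hsum]
    refine Finset.sum_eq_zero fun j hj => ?_
    by_cases hcj : c j = 0
    · rw [hcj]; simp
    · rw [hd j hj ((le_pair_of_coroot_eq_sum b hδ hc hj hcj).trans_lt hlt), mul_zero]
  rw [pair_negIndex] at h0
  omega

/-- The coefficients in the products with the Steinberg type characters only depend on the
truncation of the highest weight at level `m`. -/
theorem brauerCoeff_truncate (hp : 0 < p) (hlam : IsDominant b lam)
    (hm : pair P lam (highestCoroot b) < p * m) {η : AddMonoidAlgebra ℤ X}
    (hη : ∀ x, η.coeff x ≠ 0 → SepLE P p x lam) {δ δ' y : X} (hδ : IsStrictlyDominant b δ)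
    (hδ' : ∀ i ∈ b.support, pair P δ' i = min (pair P δ i) m)
    (hy : IsStrictlyDominant b ((p : ℤ) • δ + y)) (hy' : SepLE P p y lam) :
    IsStrictlyDominant b ((p : ℤ) • δ' + y) ∧
      brauerCoeff P p η δ y = brauerCoeff P p η δ' y := by
  have hstrict : IsStrictlyDominant b ((p : ℤ) • δ' + y) := by
    intro i hi
    rw [pair_add, pair_smul, hδ' i hi]
    rcases min_choice (pair P δ i) m with h | h
    · rw [h, ← pair_smul, ← pair_add]
      exact hy i hi
    · rw [h]
      exact isStrictlyDominant_of_sepLE hp hlam hm hy'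
  have hdom' : IsDominant b δ' := by
    intro i hi
    rw [hδ' i hi]
    exact le_min (hδ i hi).le (by positivity)
  refine ⟨hstrict, Finset.sum_congr rfl fun u _ => congrArg (sign u * ·) ?_⟩
  -- The two sums agree term by term: where either argument meets the support of `η`, `u` fixes `δ -
  -- δ'` and the arguments coincide. Otherwise both terms vanish.
  have hfix : u • (δ - δ') = δ - δ' → u • ((p : ℤ) • δ + y) - (p : ℤ) • δ =
      u • ((p : ℤ) • δ' + y) - (p : ℤ) • δ' := by
    intro h
    rw [smul_sub, sub_eq_sub_iff_add_eq_add] at h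
    rw [smul_add, smul_add, smul_zsmul, smul_zsmul, eq_sub_iff_add_eq.2 h]
    generalize u • δ' = s
    generalize u • y = t
    module
  by_cases h1 : η.coeff (u • ((p : ℤ) • δ + y) - (p : ℤ) • δ) = 0
  · by_cases h2 : η.coeff (u • ((p : ℤ) • δ' + y) - (p : ℤ) • δ') = 0
    · rw [h1, h2]
    · rw [hfix]
      refine smul_eq_self_of_sepLE hp hlam hm hdom' (fun i hi hlt => ?_) hstrict (hη _ h2)
      rw [hδ' i hi] at hlt
      rw [pair_sub, hδ' i hi]
      omega
  · rw [hfix]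
    refine smul_eq_self_of_sepLE hp hlam hm hδ.isDominant (fun i hi hlt => ?_) hy (hη _ h1)
    rw [pair_sub, hδ' i hi]
    omega

/-- Conjugate the root of the step to $-\alpha_k$ with $\alpha_k$ simple. Let $\delta$ have
coordinate $n$ at $k$, the level of the wall, and $m$ elsewhere. An inversion involving another
simple coroot kills a term of Brauer's formula, so only $u=1$ and $u=s_k$ are left. The former gives
$\eta(x)=0$ and the latter $-\eta(z)$. -/
theorem exists_brauerCoeff_eq_neg (hp : 0 < p) (hlam : IsDominant b lam)
    (hm : pair P lam (highestCoroot b) < p * m) {η : AddMonoidAlgebra ℤ X}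
    (hinv : IsWeylInvariant P η) (hη : ∀ x, η.coeff x ≠ 0 → SepLE P p x lam) {x z : X}
    (hx : η.coeff x = 0) (hxz : SepStep P p x z) (hz : SepLE P p z lam) :
    ∃ δ : X, (∀ i ∈ b.support, 0 < pair P δ i ∧ pair P δ i ≤ m) ∧ ∃ w : P.weylGroup,
      IsStrictlyDominant b ((p : ℤ) • δ + w • x) ∧ brauerCoeff P p η δ (w • x) = -η.coeff z := by
  classical
  have hp' : (0 : ℤ) < p := by exact_mod_cast hp
  obtain ⟨i, n, hn, hlt, rfl⟩ := hxz
  obtain ⟨w, k, hk, hwk⟩ := exists_smul_simple b (negIndex P i)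
  have hwi : w • i = negIndex P k := by
    rw [← hwk, ← smul_negIndex, negIndex_negIndex]
  set y := w • x with hydef
  set z := affRefl P p (negIndex P k) n y with hzdef
  have hz' : w • affRefl P p i n x = z := by rw [smul_affRefl, hwi]
  have hlt' : pair P y (negIndex P k) < n * p := by rw [← hwi, pair_weyl_smul]; exact hlt
  have hzlam : SepLE P p z lam := by rw [← hz']; exact hz.smul_left w
  have hylam : SepLE P p y lam := .head (.inl ⟨_, n, hn, hlt', rfl⟩) hzlam
  have hnm : n < m := by
    have h1 := (pair_le_of_sepLE hp hlam hzlam (negIndex P k)).trans_lt hm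
    rw [hzdef, pair_affRefl, P.pairing_same] at h1
    have h2 : (p : ℤ) * n < p * m := by linarith
    exact lt_of_mul_lt_mul_left h2 hp'.le
  obtain ⟨δ, hδ⟩ := exists_weight b fun j => if j = k then n else (m : ℤ)
  have hδk : pair P δ k = n := by rw [hδ k hk, if_pos rfl]
  have hδj : ∀ j ∈ b.support, j ≠ k → pair P δ j = m := fun j hj hjk => by rw [hδ j hj, if_neg hjk]
  have hbd : ∀ j ∈ b.support, 0 < pair P δ j ∧ pair P δ j ≤ m := by
    intro j hj
    by_cases hjk : j = k
    · subst hjk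
      rw [hδk]
      omega
    · rw [hδj j hj hjk]
      omega
  have hstrict : IsStrictlyDominant b ((p : ℤ) • δ + y) := by
    intro j hj
    rw [pair_add, pair_smul]
    by_cases hjk : j = k
    · subst hjk
      rw [hδk]
      rw [pair_negIndex] at hlt'
      linarith
    · rw [hδj j hj hjk]
      exact isStrictlyDominant_of_sepLE hp hlam hm hylam
  refine ⟨δ, hbd, w, hstrict, ?_⟩
  have hne : refl P k ≠ 1 := by
    intro h
    have h1 := refl_smul (P := P) k (P.root k)
    rw [h, one_smul, pair_root_self] at h1
    have h2 : pair P (P.root k) k = pair P (P.root k - (2 : ℤ) • P.root k) k := by rw [← h1]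
    rw [pair_sub, pair_smul, pair_root_self] at h2
    norm_num at h2
  have hvanish : ∀ u ∈ (Finset.univ.erase (1 : P.weylGroup)).erase (refl P k),
      sign u * η.coeff (u • ((p : ℤ) • δ + y) - (p : ℤ) • δ) = 0 := by
    intro u hu
    rw [Finset.mem_erase, Finset.mem_erase] at hu
    by_contra hne
    obtain ⟨j, hj, hneg, hjk⟩ := exists_inversion_ne b hu.2.1 hu.1
    have hlt := pair_negIndex_lt hp hlam hm hstrict (hη _ (right_ne_zero_of_mul hne)) hj
    rw [← isPos_negIndex_iff] at hneg
    obtain ⟨c, hc, -⟩ := exists_pair_eq_sum b hneg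
    obtain ⟨l, hl, hlk, hcl⟩ := exists_coeff_ne_zero_of_ne b hneg hk (by
      intro h
      apply hjk
      rw [← h, negIndex_negIndex]) hc
    have := le_pair_of_coroot_eq_sum b (fun j hj => (hbd j hj).1.le) hc hl hcl
    rw [hδj l hl hlk] at this
    omega
  rw [brauerCoeff, ← Finset.add_sum_erase _ _ (Finset.mem_univ (1 : P.weylGroup)),
    ← Finset.add_sum_erase _ _ (Finset.mem_erase.2 ⟨hne, Finset.mem_univ (refl P k)⟩),
    Finset.sum_eq_zero hvanish, sign_one, one_smul, add_sub_cancel_left]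
  have hxy : η.coeff y = 0 := (hinv w x).trans hx
  have hrefl : refl P k • ((p : ℤ) • δ + y) - (p : ℤ) • δ = z := by
    rw [hzdef, affRefl, refl_smul, pair_add, pair_smul, hδk, pair_negIndex, root_negIndex]
    clear_value y
    module
  rw [← hinv w (affRefl P p i n x), hz', hrefl, hxy, sign_refl b]
  ring

end BrauerCoefficients

-- Translation of the algorithm's data into Brauer coefficients

section Steinberg

variable {ι X Y : Type*} [Finite ι] [AddCommGroup X] [AddCommGroup Y] {P : RootPairing ι ℤ X Y}
  [P.IsReduced] [IsSimplyConnected P] {b : P.Base} {p : ℕ}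

omit [Finite ι] [P.IsReduced] in
theorem steinbergWeight_add (γ y : X) :
    steinbergWeight b p γ + y + rho b = (p : ℤ) • (γ + rho b) + y := by
  rw [steinbergWeight]
  module

omit [Finite ι] [P.IsReduced] in
theorem isDominant_steinbergWeight (hp : 0 < p) {γ : X} (hγ : IsDominant b γ) :
    IsDominant b (steinbergWeight b p γ) := by
  intro i hi
  have hp' : (1 : ℤ) ≤ p := by exact_mod_cast hp
  rw [steinbergWeight, pair_add, pair_smul, pair_smul, pair_rho b hi]
  have := mul_nonneg (zero_le_one.trans hp') (hγ i hi)
  linarith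

omit [Finite ι] [P.IsReduced] in
theorem isDominant_steinbergWeight_add_iff {γ y : X} :
    IsDominant b (steinbergWeight b p γ + y) ↔
      IsStrictlyDominant b ((p : ℤ) • (γ + rho b) + y) := by
  rw [← steinbergWeight_add]
  refine ⟨isStrictlyDominant_add_rho b, fun h => ?_⟩
  have := isDominant_sub_rho b h
  rwa [add_sub_cancel_right] at this

theorem altCoeff_steinbergWeight {η : AddMonoidAlgebra ℤ X} (hη : IsWeylInvariant P η) {γ y : X}
    (hγ : IsDominant b (steinbergWeight b p γ)) (hy : IsDominant b (steinbergWeight b p γ + y)) :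
    altCoeff b (weylChar b (steinbergWeight b p γ) * η * alternant P (rho b))
      (steinbergWeight b p γ + y) = brauerCoeff P p η (γ + rho b) y := by
  have h := steinbergWeight_add (b := b) (p := p) γ 0
  rw [add_zero, add_zero] at h
  rw [altCoeff_weylChar_mul b hη hγ hy, steinbergWeight_add, h, brauerCoeff]

/-- The coefficients that are compared in the algorithm, for the orbit of `μ`. -/
def orbitCoeffs (b : P.Base) (p m : ℕ) (η : AddMonoidAlgebra ℤ X) (μ : X) : Set ℤ :=
  {z | ∃ δ : X, (∀ i ∈ b.support, 0 < pair P δ i ∧ pair P δ i ≤ m) ∧ ∃ w : P.weylGroup,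
    IsStrictlyDominant b ((p : ℤ) • δ + w • μ) ∧ z = brauerCoeff P p η δ (w • μ)}

omit [P.IsReduced] in
theorem finite_orbitCoeffs (m : ℕ) (η : AddMonoidAlgebra ℤ X) (μ : X) :
    (orbitCoeffs b p m η μ).Finite := by
  have h : {δ : X | ∀ i ∈ b.support, 0 < pair P δ i ∧ pair P δ i ≤ m}.Finite :=
    finite_of_pair_mem b (m := 0) (M := m) fun δ hδ i hi => ⟨(hδ i hi).1.le, (hδ i hi).2⟩
  refine ((h.prod (Set.finite_univ (α := P.weylGroup))).image
    fun q => brauerCoeff P p η q.1 (q.2 • μ)).subset ?_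
  rintro z ⟨δ, hδ, w, -, rfl⟩
  exact ⟨(δ, w), ⟨hδ, Set.mem_univ _⟩, rfl⟩

omit [Finite ι] [P.IsReduced] in
theorem mem_restrictedWeights_iff {m : ℕ} {γ : X} : γ ∈ restrictedWeights b m ↔
    ∀ i ∈ b.support, 0 < pair P (γ + rho b) i ∧ pair P (γ + rho b) i ≤ m := by
  refine forall₂_congr fun i hi => ?_
  rw [pair_add, pair_rho b hi]
  omega

omit [Finite ι] [P.IsReduced] in
theorem finite_restrictedWeights (m : ℕ) : (restrictedWeights b m).Finite :=
  finite_of_pair_mem b (m := 0) (M := m) fun _ hγ i hi => ⟨(hγ i hi).1, (hγ i hi).2.le⟩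

variable [IsIrreducibleDatum P] {lam : X}

/-- Uniqueness of expansions removes the choice of `a`. The substitution $\delta=\gamma+\rho$ turns
coordinates in $[0,m)$ into coordinates in $[1,m]$. -/
theorem isLeastCoeff_iff (hp : 0 < p) {η : AddMonoidAlgebra ℤ X} (hη : IsWeylInvariant P η) {μ : X}
    {x : ℤ} :
    IsLeastCoeff b p lam η μ x ↔ IsLeast (orbitCoeffs b p (bound b p lam) η μ) x := by
  have hdom : ∀ γ ∈ restrictedWeights b (bound b p lam), IsDominant b (steinbergWeight b p γ) :=
    fun γ hγ => isDominant_steinbergWeight hp fun i hi => (hγ i hi).1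
  have hexp : ∀ γ ∈ restrictedWeights b (bound b p lam), ∀ c : X →₀ ℤ,
      IsWeylExpansion b (weylChar b (steinbergWeight b p γ) * η) c ↔
        c = altCoeff b (weylChar b (steinbergWeight b p γ) * η * alternant P (rho b)) :=
    fun γ hγ c => isWeylExpansion_iff b ((isWeylInvariant_weylChar b (hdom γ hγ)).mul hη)
  have hset : ∀ a : X → X →₀ ℤ,
      (∀ γ ∈ restrictedWeights b (bound b p lam),
        IsWeylExpansion b (weylChar b (steinbergWeight b p γ) * η) (a γ)) →
      {z : ℤ | ∃ γ ∈ restrictedWeights b (bound b p lam), ∃ w : P.weylGroup,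
        IsDominant b (steinbergWeight b p γ + w • μ) ∧ z = a γ (steinbergWeight b p γ + w • μ)} =
      orbitCoeffs b p (bound b p lam) η μ := by
    intro a ha
    ext z
    constructor
    · rintro ⟨γ, hγ, w, hw, rfl⟩
      refine ⟨γ + rho b, mem_restrictedWeights_iff.1 hγ, w,
        isDominant_steinbergWeight_add_iff.1 hw, ?_⟩
      rw [(hexp γ hγ _).1 (ha γ hγ), altCoeff_steinbergWeight hη (hdom γ hγ) hw]
    · rintro ⟨δ, hδ, w, hw, rfl⟩
      obtain ⟨γ, rfl⟩ : ∃ γ, δ = γ + rho b := ⟨δ - rho b, (sub_add_cancel _ _).symm⟩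
      have hγ := mem_restrictedWeights_iff.2 hδ
      have hw' := isDominant_steinbergWeight_add_iff.2 hw
      refine ⟨γ, hγ, w, hw', ?_⟩
      rw [(hexp γ hγ _).1 (ha γ hγ), altCoeff_steinbergWeight hη (hdom γ hγ) hw']
  constructor
  · rintro ⟨a, ha, hx⟩
    rwa [hset a ha] at hx
  · intro hx
    refine ⟨_, fun γ hγ => (hexp γ hγ _).2 rfl, ?_⟩
    rwa [hset _ fun γ hγ => (hexp γ hγ _).2 rfl]

omit [P.IsReduced] in
theorem lt_bound (hp : 0 < p) :
    pair P lam (highestCoroot b) < p * bound b p lam := by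
  have hne : {m : ℕ | pair P lam (highestCoroot b) < p * m}.Nonempty := by
    refine ⟨(pair P lam (highestCoroot b)).toNat + 1, ?_⟩
    have h1 := Int.self_le_toNat (pair P lam (highestCoroot b))
    have h2 : (1 : ℤ) ≤ p := by exact_mod_cast hp
    have h3 : (0 : ℤ) ≤ (pair P lam (highestCoroot b)).toNat := by positivity
    change _ < (p : ℤ) * ((_ + 1 : ℕ) : ℤ)
    push_cast
    nlinarith
  exact Nat.sInf_mem hne

omit [IsIrreducibleDatum P] in
theorem mem_psiPlus_iff (hp : 0 < p) (hlam : IsDominant b lam) {γ : X} :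
    γ ∈ psiPlus b p lam ↔ IsDominant b γ ∧ SepLE P p γ lam :=
  and_congr_right fun hγ => upArrow_iff_sepLE hp hγ hlam

omit [IsIrreducibleDatum P] in
theorem dom_mem_psiPlus (hp : 0 < p) (hlam : IsDominant b lam) {x : X} (hx : SepLE P p x lam) :
    dom b x ∈ psiPlus b p lam := by
  rw [mem_psiPlus_iff hp hlam]
  obtain ⟨w, hw⟩ := exists_dom_eq_smul b x
  refine ⟨isDominant_dom b x, ?_⟩
  rw [hw]
  exact hx.smul_left w

theorem finite_psiPlus (hp : 0 < p) (hlam : IsDominant b lam) : (psiPlus b p lam).Finite := by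
  refine finite_of_pair_mem b (m := 0) (M := pair P lam (highestCoroot b)) fun x hx i hi => ?_
  rw [mem_psiPlus_iff hp hlam] at hx
  exact ⟨hx.1 i hi, pair_le_of_sepLE hp hlam hx.2 i⟩

omit [IsIrreducibleDatum P] in
theorem SepLE.weightLE (hp : 0 < p) {x y : X} (hx : IsDominant b x) (h : SepLE P p x y) :
    WeightLE b x (dom b y) := by
  have := (h.up_dom (b := b) hp).weightLE
  rwa [dom_of_isDominant b hx] at this

end Steinberg

-- Invariants of the algorithm, termination and uniqueness of the output

section Stages

variable {ι X Y : Type*} [Finite ι] [AddCommGroup X] [AddCommGroup Y] {P : RootPairing ι ℤ X Y}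
  [P.IsReduced] [IsIrreducibleDatum P] [IsSimplyConnected P] {b : P.Base} {p : ℕ} {lam : X}
  {η η' : AddMonoidAlgebra ℤ X}

/-- The properties shared by all stages of the algorithm. -/
structure IsStage (b : P.Base) (p : ℕ) (lam : X) (η : AddMonoidAlgebra ℤ X) : Prop where
  invariant : IsWeylInvariant P η
  sepLE : ∀ x, η.coeff x ≠ 0 → SepLE P p x lam
  coeff_lam : η.coeff lam = 1
  nonneg : ∀ x, 0 ≤ η.coeff x
  -- Treated weights are closed upwards, so a later change never occurs above a treated weight. This
  -- is what preserves the last property.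
  upper : ∀ ν ∈ psiPlus b p lam, ∀ ν' ∈ psiPlus b p lam, WeightLE b ν ν' → η.coeff ν ≠ 0 →
    η.coeff ν' ≠ 0
  isLeast : ∀ ν ∈ psiPlus b p lam, η.coeff ν ≠ 0 → ν ≠ lam →
    IsLeast (orbitCoeffs b p (bound b p lam) η ν) 0

omit [IsIrreducibleDatum P] in
theorem IsWeylInvariant.coeff_dom (h : IsWeylInvariant P η) (x : X) :
    η.coeff (dom b x) = η.coeff x := by
  obtain ⟨w, hw⟩ := exists_dom_eq_smul b x
  rw [hw, h]

open Classical in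
omit [IsIrreducibleDatum P] in
theorem coeff_orbitSum_eq_ite (μ x : X) (hμ : IsDominant b μ) :
    (orbitSum P μ).coeff x = if dom b x = μ then 1 else 0 := by
  rw [coeff_orbitSum]
  refine if_congr ?_ rfl rfl
  rw [← dom_eq_dom_iff b, dom_of_isDominant b hμ, eq_comm]

theorem isStage_orbitSum (hp : 0 < p) (hlam : IsDominant b lam) :
    IsStage b p lam (orbitSum P lam) := by
  classical
  have hmem : ∀ x, (orbitSum P lam).coeff x ≠ 0 → dom b x = lam := by
    intro x hx
    by_contra h
    rw [coeff_orbitSum_eq_ite (b := b) lam x hlam, if_neg h] at hx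
    exact hx rfl
  have hmem' : ∀ ν ∈ psiPlus b p lam, (orbitSum P lam).coeff ν ≠ 0 → ν = lam := by
    intro ν hν h
    rw [← hmem ν h, dom_of_isDominant b hν.1]
  refine ⟨isWeylInvariant_orbitSum lam, fun x hx => ?_, ?_, fun x => ?_,
    fun ν hν ν' hν' h hne => ?_, fun ν hν h hne => absurd (hmem' ν hν h) hne⟩
  · obtain ⟨w, hw⟩ := exists_dom_eq_smul b x
    rw [← hmem x hx, hw]
    exact .of_smul w x
  · rw [coeff_orbitSum_eq_ite (b := b) lam lam hlam, if_pos (dom_of_isDominant b hlam)]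
  · rw [coeff_orbitSum_eq_ite (b := b) lam x hlam]
    split_ifs <;> norm_num
  · have hνl := hmem' ν hν hne
    subst hνl
    rw [mem_psiPlus_iff hp hlam] at hν'
    have h2 := hν'.2.weightLE hp hν'.1
    rw [dom_of_isDominant b hlam] at h2
    rwa [h2.antisymm h]

namespace IsStage

/-- The negative element forces $x_\mu<0$. As $\mu$ is not in the orbit of $\lambda$, a chain to
$\lambda$ contains a first separating step, to some $z$ with a strictly higher dominant
representative. Maximality of $\mu$ gives $\eta(z)\ne 0$, hence $\eta(z)>0$, and $-\eta(z)$ is one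
of the coefficients. -/
theorem orbitCoeffs_nonempty (hp : 0 < p) (hlam : IsDominant b lam) (hη : IsStage b p lam η) {μ : X}
    (hμ : IsChoice b p lam η μ) : ∃ z ∈ orbitCoeffs b p (bound b p lam) η μ, z < 0 := by
  obtain ⟨hμΨ, h0, hmax⟩ := hμ
  obtain ⟨hdom, hsep⟩ := (mem_psiPlus_iff hp hlam).1 hμΨ
  have hne : ∀ w : P.weylGroup, lam ≠ w • μ := by
    intro w h
    have := hη.coeff_lam
    rw [h, hη.invariant, h0] at this
    exact zero_ne_one this
  obtain ⟨w, z, hstep, hz⟩ := hsep.exists_step hne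
  have hzne : η.coeff z ≠ 0 := by
    intro h
    rw [← hη.invariant.coeff_dom (b := b)] at h
    have hlt := hstep.posHeight_lt (b := b) hp
    rw [dom_smul, dom_of_isDominant b hdom] at hlt
    have hle := ((SepLE.of_step hstep).up_dom (b := b) hp).weightLE
    rw [dom_smul, dom_of_isDominant b hdom] at hle
    rw [hmax _ (dom_mem_psiPlus hp hlam hz) h hle] at hlt
    exact lt_irrefl _ hlt
  obtain ⟨δ, hδ, v, hv, heq⟩ := exists_brauerCoeff_eq_neg hp hlam (lt_bound hp) hη.invariant
    hη.sepLE (by rw [hη.invariant, h0]) hstep hz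
  refine ⟨-η.coeff z, ⟨δ, hδ, v * w, by rwa [mul_smul], by rw [mul_smul, heq]⟩, ?_⟩
  have := hη.nonneg z
  omega

theorem existsUnique_isLeastCoeff (hp : 0 < p) (hlam : IsDominant b lam) (hη : IsStage b p lam η)
    {μ : X} (hμ : IsChoice b p lam η μ) : ∃! x, IsLeastCoeff b p lam η μ x := by
  obtain ⟨z, hz, -⟩ := hη.orbitCoeffs_nonempty hp hlam hμ
  obtain ⟨x, hx, hmin⟩ := Set.exists_min_image _ id (finite_orbitCoeffs (b := b) (p := p) _ η μ) ⟨z, hz⟩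
  have hleast : IsLeast (orbitCoeffs b p (bound b p lam) η μ) x := ⟨hx, hmin⟩
  exact ⟨x, (isLeastCoeff_iff hp hη.invariant).2 hleast,
    fun y hy => ((isLeastCoeff_iff hp hη.invariant).1 hy).unique hleast⟩

theorem step (hp : 0 < p) (hlam : IsDominant b lam) (hη : IsStage b p lam η)
    (h : Step b p lam η η') : IsStage b p lam η' ∧
      {ν ∈ psiPlus b p lam | η'.coeff ν = 0} ⊂ {ν ∈ psiPlus b p lam | η.coeff ν = 0} := by
  classical
  obtain ⟨μ, x, hμ, hx, rfl⟩ := h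
  rw [isLeastCoeff_iff hp hη.invariant] at hx
  have hx0 : x < 0 := by
    obtain ⟨z, hz, hz0⟩ := hη.orbitCoeffs_nonempty hp hlam hμ
    exact (hx.2 hz).trans_lt hz0
  obtain ⟨hμΨ, h0, hmax⟩ := hμ
  obtain ⟨hdom, hsep⟩ := (mem_psiPlus_iff hp hlam).1 hμΨ
  have hcoeff : ∀ y, (η - x • orbitSum P μ).coeff y =
      η.coeff y - if dom b y = μ then x else 0 := by
    intro y
    have : (η - x • orbitSum P μ).coeff y = η.coeff y - x * (orbitSum P μ).coeff y := rfl
    rw [this, coeff_orbitSum_eq_ite (b := b) μ y hdom, mul_ite, mul_one, mul_zero]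
  have hinv := hη.invariant.sub_zsmul (isWeylInvariant_orbitSum μ) x
  set η' := η - x • orbitSum P μ with hη'
  have hself : η'.coeff μ = -x := by
    rw [hcoeff, if_pos (dom_of_isDominant b hdom), h0, zero_sub]
  have hother : ∀ y, dom b y ≠ μ → η'.coeff y = η.coeff y := by
    intro y hy
    rw [hcoeff, if_neg hy, sub_zero]
  have hotherΨ : ∀ ν ∈ psiPlus b p lam, ν ≠ μ → η'.coeff ν = η.coeff ν := fun ν hν hne =>
    hother ν (by rwa [dom_of_isDominant b hν.1])
  have hlamμ : lam ≠ μ := by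
    rintro rfl
    exact zero_ne_one (h0.symm.trans hη.coeff_lam)
  refine ⟨⟨hinv, fun y hy => ?_, ?_, fun y => ?_, fun ν hν ν' hν' hle hne => ?_,
    fun ν hν hne hνlam => ?_⟩, ?_⟩
  · by_cases hyμ : dom b y = μ
    · obtain ⟨w, hw⟩ := exists_dom_eq_smul b y
      rw [← hyμ, hw] at hsep
      simpa using hsep.smul_left w⁻¹
    · exact hη.sepLE y (by rwa [← hother y hyμ])
  · rw [hother lam (by rwa [dom_of_isDominant b hlam]), hη.coeff_lam]
  · have := hη.nonneg y
    rw [hcoeff]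
    split_ifs <;> omega
  · by_cases h' : ν' = μ
    · rw [h', hself]
      omega
    · rw [hotherΨ ν' hν' h']
      by_cases h : ν = μ
      · intro h3
        exact h' (hmax ν' hν' h3 (h ▸ hle))
      · rw [hotherΨ ν hν h] at hne
        exact hη.upper ν hν ν' hν' hle hne
  · by_cases h : ν = μ
    · subst h
      -- The other terms of Brauer's formula sit at weights of greater dominant height, outside the
      -- orbit just changed. All coefficients for this orbit therefore move by `-x`, and the least
      -- becomes `0`.
      have key : ∀ δ : X, (∀ i ∈ b.support, 0 < pair P δ i ∧ pair P δ i ≤ bound b p lam) →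
          ∀ w : P.weylGroup, IsStrictlyDominant b ((p : ℤ) • δ + w • ν) →
            brauerCoeff P p η' δ (w • ν) = brauerCoeff P p η δ (w • ν) - x := by
        intro δ hδ w hw
        have := brauerCoeff_sub_eq (η := η') (η' := η) hp (fun i hi => (hδ i hi).1) hw
          fun z hz hlt => hother z fun hzν => by
            rw [hzν, dom_smul, dom_of_isDominant b hdom] at hlt
            exact lt_irrefl _ hlt
        rw [hinv, hself, hη.invariant, h0] at this
        linarith
      constructor
      · obtain ⟨δ, hδ, w, hw, hxw⟩ := hx.1
        exact ⟨δ, hδ, w, hw, by rw [key δ hδ w hw, ← hxw, sub_self]⟩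
      · rintro z ⟨δ, hδ, w, hw, rfl⟩
        rw [key δ hδ w hw, sub_nonneg]
        exact hx.2 ⟨δ, hδ, w, hw, rfl⟩
    · rw [hotherΨ ν hν h] at hne
      -- A term in the orbit of `μ` would put `μ` above the treated weight `ν`, and `μ` would
      -- already be treated.
      have key : orbitCoeffs b p (bound b p lam) η' ν = orbitCoeffs b p (bound b p lam) η ν := by
        ext z
        refine exists_congr fun δ => and_congr_right fun hδ => exists_congr fun w =>
          and_congr_right fun hw => ?_
        have := brauerCoeff_sub_eq (η := η') (η' := η) hp (fun i hi => (hδ i hi).1) hw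
          fun z hz _ => hother z fun hzμ => by
            have hle := (hz.up_dom (b := b) hp).weightLE
            rw [dom_smul, dom_of_isDominant b hν.1, hzμ] at hle
            exact hη.upper ν hν μ hμΨ hle hne h0
        rw [hinv, hη.invariant, hotherΨ ν hν h, sub_left_inj] at this
        rw [this]
      rw [key]
      exact hη.isLeast ν hν hne hνlam
  · rw [Set.ssubset_iff_of_subset]
    · exact ⟨μ, ⟨hμΨ, h0⟩, fun h => by
        have := h.2
        rw [hself] at this
        omega⟩
    · rintro ν ⟨hν, h⟩
      by_cases hνμ : ν = μ
      · rw [hνμ, hself] at h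
        omega
      · exact ⟨hν, by rwa [← hotherΨ ν hν hνμ]⟩

theorem of_isReachable (hp : 0 < p) (hlam : IsDominant b lam) (h : IsReachable b p lam η) :
    IsStage b p lam η := by
  induction h with
  | refl => exact isStage_orbitSum hp hlam
  | tail _ h ih => exact (ih.step hp hlam h).1

/-- Evaluate both elements at a pair $(\delta,w)$ where $\eta$ attains its least coefficient $0$.
The coefficient of $\eta'$ there is nonnegative, and since the higher terms agree, the two
coefficients differ by $\eta'(\nu)-\eta(\nu)$. -/
theorem coeff_le_of_forall_lt (hp : 0 < p) (hlam : IsDominant b lam) (hη : IsStage b p lam η)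
    (hη' : IsStage b p lam η') {ν : X} (hν : ν ∈ psiPlus b p lam) (hνlam : ν ≠ lam)
    (h1 : η.coeff ν ≠ 0) (h2 : η'.coeff ν ≠ 0)
    (h : ∀ κ ∈ psiPlus b p lam, posHeight b ν < posHeight b κ → η.coeff κ = η'.coeff κ) :
    η.coeff ν ≤ η'.coeff ν := by
  obtain ⟨δ, hδ, w, hw, h0⟩ := (hη.isLeast ν hν h1 hνlam).1
  have hle := (hη'.isLeast ν hν h2 hνlam).2 ⟨δ, hδ, w, hw, rfl⟩
  have := brauerCoeff_sub_eq (η := η) (η' := η') hp (fun i hi => (hδ i hi).1) hw fun x hx hlt => by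
    by_cases hxlam : SepLE P p x lam
    · rw [dom_smul, dom_of_isDominant b hν.1] at hlt
      rw [← hη.invariant.coeff_dom (b := b), ← hη'.invariant.coeff_dom (b := b)]
      exact h _ (dom_mem_psiPlus hp hlam hxlam) hlt
    · rw [not_not.1 fun h => hxlam (hη.sepLE x h), not_not.1 fun h => hxlam (hη'.sepLE x h)]
  rw [← h0, hη.invariant, hη'.invariant] at this
  linarith

theorem eq_of_forall_ne_zero (hp : 0 < p) (hlam : IsDominant b lam) (hη : IsStage b p lam η)
    (hη' : IsStage b p lam η') (h1 : ∀ ν ∈ psiPlus b p lam, η.coeff ν ≠ 0)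
    (h2 : ∀ ν ∈ psiPlus b p lam, η'.coeff ν ≠ 0) : η = η' := by
  have key : ∀ ν ∈ psiPlus b p lam, η.coeff ν = η'.coeff ν := by
    intro ν
    induction hN : (posHeight b lam - posHeight b ν).toNat using Nat.strong_induction_on
      generalizing ν with
    | _ N ih =>
      intro hν
      by_cases hνlam : ν = lam
      · rw [hνlam, hη.coeff_lam, hη'.coeff_lam]
      · have habove : ∀ κ ∈ psiPlus b p lam, posHeight b ν < posHeight b κ →
            η.coeff κ = η'.coeff κ := by
          intro κ hκ hlt
          refine ih _ ?_ κ rfl hκ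
          have hκ' := (mem_psiPlus_iff hp hlam).1 hκ
          have hle := (hκ'.2.weightLE hp hκ'.1).posHeight_le
          rw [dom_of_isDominant b hlam] at hle
          omega
        exact le_antisymm
          (hη.coeff_le_of_forall_lt hp hlam hη' hν hνlam (h1 ν hν) (h2 ν hν) habove)
          (hη'.coeff_le_of_forall_lt hp hlam hη hν hνlam (h2 ν hν) (h1 ν hν)
            fun κ hκ hlt => (habove κ hκ hlt).symm)
  ext x
  by_cases hxlam : SepLE P p x lam
  · rw [← hη.invariant.coeff_dom (b := b), ← hη'.invariant.coeff_dom (b := b)]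
    exact key _ (dom_mem_psiPlus hp hlam hxlam)
  · rw [not_not.1 fun h => hxlam (hη.sepLE x h), not_not.1 fun h => hxlam (hη'.sepLE x h)]

theorem brauerCoeff_eq_one (hp : 0 < p) (hlam : IsDominant b lam) (hη : IsStage b p lam η) {δ y : X}
    (hδ : IsStrictlyDominant b δ) (hy : IsStrictlyDominant b ((p : ℤ) • δ + y))
    (hylam : dom b y = lam) : brauerCoeff P p η δ y = 1 := by
  have := brauerCoeff_sub_eq (η := η) (η' := 0) hp hδ hy fun x _ hlt => by
    change _ = (0 : ℤ)
    by_contra h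
    have hle := ((hη.sepLE x h).up_dom (b := b) hp).weightLE.posHeight_le
    rw [dom_of_isDominant b hlam, ← hylam] at hle
    omega
  have h0 : brauerCoeff P p (0 : AddMonoidAlgebra ℤ X) δ y = 0 :=
    Finset.sum_eq_zero fun _ _ => mul_zero _
  have h1 : (0 : AddMonoidAlgebra ℤ X).coeff y = 0 := rfl
  rw [← hη.invariant.coeff_dom (b := b), hylam, hη.coeff_lam, h0, h1] at this
  omega

/-- The coefficient is $0$ if $y$ is not below $\lambda$ and $1$ on the orbit of $\lambda$. In the
remaining case truncation makes it one of the coefficients inspected by the algorithm, whose minimum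
is $0$. -/
theorem brauerCoeff_nonneg (hp : 0 < p) (hlam : IsDominant b lam) (hη : IsStage b p lam η)
    (hne : ∀ ν ∈ psiPlus b p lam, η.coeff ν ≠ 0) {δ y : X}
    (hδ : IsStrictlyDominant b δ) (hy : IsStrictlyDominant b ((p : ℤ) • δ + y)) :
    0 ≤ brauerCoeff P p η δ y := by
  by_cases hylam : SepLE P p y lam
  · by_cases hdom : dom b y = lam
    · rw [hη.brauerCoeff_eq_one hp hlam hδ hy hdom]
      exact zero_le_one
    · obtain ⟨δ', hδ'⟩ := exists_weight b fun i => min (pair P δ i) (bound b p lam)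
      obtain ⟨h1, h2⟩ := brauerCoeff_truncate hp hlam (lt_bound hp) hη.sepLE hδ hδ' hy hylam
      have hΨ := dom_mem_psiPlus hp hlam hylam
      obtain ⟨w, hw⟩ := exists_dom_eq_smul b y
      have hyw : w⁻¹ • dom b y = y := by rw [hw, inv_smul_smul]
      rw [h2]
      -- Needed for the truncated weight to stay strictly dominant.
      have hm : 0 < bound b p lam := by
        have h3 := lt_bound (b := b) (lam := lam) hp
        have h4 := pair_nonneg b hlam (isPos_highestCoroot b)
        by_contra! h5
        rw [Nat.le_zero.1 h5] at h3
        simp at h3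
        omega
      refine (hη.isLeast _ hΨ (hne _ hΨ) hdom).2 ⟨δ', fun i hi => ?_, w⁻¹, by rwa [hyw], by rw [hyw]⟩
      have := hδ i hi
      rw [hδ' i hi]
      omega
  · refine (brauerCoeff_eq_zero hp hδ hy fun x hx => ?_).ge
    by_contra h
    exact hylam (Relation.ReflTransGen.trans hx (hη.sepLE x h))

theorem hasGoodSteinbergMult (hp : 0 < p) (hlam : IsDominant b lam) (hη : IsStage b p lam η)
    (hne : ∀ ν ∈ psiPlus b p lam, η.coeff ν ≠ 0) : HasGoodSteinbergMult b p η := by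
  refine ⟨hη.invariant, fun γ hγ => ?_⟩
  rw [mul_comm]
  have hdom := isDominant_steinbergWeight hp hγ
  have hinv := (isWeylInvariant_weylChar b hdom).mul hη.invariant
  have hδ := isStrictlyDominant_add_rho b hγ
  refine ⟨fun h0 => ?_, hinv, _, (isWeylExpansion_iff b hinv).2 rfl, fun ν => ?_⟩
  -- The product is nonzero because its coefficient at this top weight is `1`.
  · have h1 : IsDominant b (steinbergWeight b p γ + lam) := by
      intro i hi
      rw [pair_add]
      exact add_nonneg (hdom i hi) (hlam i hi)
    have h2 := altCoeff_steinbergWeight hη.invariant hdom h1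
    rw [hη.brauerCoeff_eq_one hp hlam hδ (isDominant_steinbergWeight_add_iff.1 h1)
      (dom_of_isDominant b hlam), h0, zero_mul, altCoeff_apply b _ h1] at h2
    exact zero_ne_one h2
  · by_cases hν : IsDominant b ν
    · obtain ⟨y, rfl⟩ : ∃ y, ν = steinbergWeight b p γ + y :=
        ⟨ν - steinbergWeight b p γ, (add_sub_cancel _ _).symm⟩
      rw [altCoeff_steinbergWeight hη.invariant hdom hν]
      exact hη.brauerCoeff_nonneg hp hlam hne hδ (isDominant_steinbergWeight_add_iff.1 hν)
    · rw [Finsupp.notMem_support_iff.1 fun h => hν (isDominant_of_mem_support_altCoeff b h)]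

end IsStage

theorem exists_isChoice (hp : 0 < p) (hlam : IsDominant b lam)
    {ν : X} (hν : ν ∈ psiPlus b p lam) (h : η.coeff ν = 0) : ∃ μ, IsChoice b p lam η μ := by
  obtain ⟨μ, ⟨h1, h2⟩, hmax⟩ := Set.exists_max_image {ν ∈ psiPlus b p lam | η.coeff ν = 0}
    (posHeight b) ((finite_psiPlus hp hlam).subset fun _ h => h.1) ⟨ν, hν, h⟩
  refine ⟨μ, h1, h2, fun μ' h1' h2' hle => ?_⟩
  rcases hle.eq_or_lt with h | h
  · exact h.symm
  · exact absurd (hmax μ' ⟨h1', h2'⟩) (by omega)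

theorem exists_isOutput (hp : 0 < p) (hlam : IsDominant b lam) (h : IsReachable b p lam η) :
    ∃ M, IsOutput b p lam M := by
  induction hN : {ν ∈ psiPlus b p lam | η.coeff ν = 0}.ncard using Nat.strong_induction_on
    generalizing η with
  | _ N ih =>
    by_cases hμ : ∃ μ, IsChoice b p lam η μ
    · obtain ⟨μ, hμ⟩ := hμ
      have hη := IsStage.of_isReachable hp hlam h
      obtain ⟨x, hx, -⟩ := hη.existsUnique_isLeastCoeff hp hlam hμ
      have hstep : Step b p lam η (η - x • orbitSum P μ) := ⟨μ, x, hμ, hx, rfl⟩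
      refine ih _ ?_ (h.tail hstep) rfl
      rw [← hN]
      exact Set.ncard_lt_ncard (hη.step hp hlam hstep).2
        ((finite_psiPlus hp hlam).subset fun _ h => h.1)
    · exact ⟨η, h, not_exists.1 hμ⟩

theorem length_le_ncard_psiPlus (hp : 0 < p) (hlam : IsDominant b lam) {k : ℕ}
    {f : ℕ → AddMonoidAlgebra ℤ X} (h0 : f 0 = orbitSum P lam)
    (h : ∀ i < k, Step b p lam (f i) (f (i + 1))) : k ≤ (psiPlus b p lam).ncard := by
  have key : ∀ i ≤ k, IsStage b p lam (f i) ∧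
      {ν ∈ psiPlus b p lam | (f i).coeff ν = 0}.ncard + i ≤ (psiPlus b p lam).ncard := by
    intro i
    induction i with
    | zero =>
      intro _
      rw [h0]
      exact ⟨isStage_orbitSum hp hlam,
        Set.ncard_le_ncard (fun _ h => h.1) (finite_psiPlus hp hlam)⟩
    | succ i ih =>
      intro hi
      obtain ⟨h1, h2⟩ := ih (by omega)
      obtain ⟨h3, h4⟩ := h1.step hp hlam (h i (by omega))
      have := Set.ncard_lt_ncard h4 ((finite_psiPlus hp hlam).subset fun _ h => h.1)
      exact ⟨h3, by omega⟩
  have := (key k le_rfl).2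
  omega

end Stages

end SteinbergMult

end

-- The main theorem

theorem mainTheorem7 {ι X Y : Type*} [Finite ι] [AddCommGroup X] [AddCommGroup Y]
    (P : RootPairing ι ℤ X Y) [P.IsReduced] [SteinbergMult.IsIrreducibleDatum P]
    [SteinbergMult.IsSimplyConnected P] (b : P.Base) (p : ℕ) (hp : p.Prime)
    (lam : X) (hlam : SteinbergMult.IsDominant b lam) :
    -- every stage is a well-defined finite computation
    ((SteinbergMult.psiPlus b p lam).Finite ∧
      (SteinbergMult.restrictedWeights b (SteinbergMult.bound b p lam)).Finite ∧
      Finite P.weylGroup ∧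
      ∀ η, SteinbergMult.IsReachable b p lam η → ∀ μ, SteinbergMult.IsChoice b p lam η μ →
        ∃! x : ℤ, SteinbergMult.IsLeastCoeff b p lam η μ x) ∧
    -- every run stops after a bounded number of passes through the loop
    (∃ N : ℕ, ∀ (k : ℕ) (f : ℕ → AddMonoidAlgebra ℤ X),
      f 0 = SteinbergMult.orbitSum P lam →
      (∀ i < k, SteinbergMult.Step b p lam (f i) (f (i + 1))) → k ≤ N) ∧
    -- all runs return the same element, and it has the good Steinberg multiplication property
    ∃ M : AddMonoidAlgebra ℤ X, SteinbergMult.IsOutput b p lam M ∧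
      (∀ M', SteinbergMult.IsOutput b p lam M' → M' = M) ∧
      SteinbergMult.HasGoodSteinbergMult b p M := by
  open SteinbergMult in
  have hp0 := hp.pos
  refine ⟨⟨finite_psiPlus hp0 hlam, finite_restrictedWeights _, inferInstance, fun η hη μ hμ =>
    (IsStage.of_isReachable hp0 hlam hη).existsUnique_isLeastCoeff hp0 hlam hμ⟩,
    ⟨_, fun k f h0 h => length_le_ncard_psiPlus hp0 hlam h0 h⟩, ?_⟩
  have hne {M : AddMonoidAlgebra ℤ X} (hM : IsOutput b p lam M) :
      ∀ ν ∈ psiPlus b p lam, M.coeff ν ≠ 0 := fun ν hν h => by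
    obtain ⟨μ, hμ⟩ := exists_isChoice hp0 hlam hν h
    exact hM.2 μ hμ
  have hstage {M : AddMonoidAlgebra ℤ X} (hM : IsOutput b p lam M) : IsStage b p lam M :=
    .of_isReachable hp0 hlam hM.1
  obtain ⟨M, hM⟩ := exists_isOutput hp0 hlam (η := orbitSum P lam) .refl
  exact ⟨M, hM, fun M' hM' => (hstage hM').eq_of_forall_ne_zero hp0 hlam (hstage hM) (hne hM')
    (hne hM), (hstage hM).hasGoodSteinbergMult hp0 hlam (hne hM)⟩
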